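/- Let $n\ge 1$, let $q\in\mathbb C^\times$ be not a root of unity, and let $U_q(\mathfrak g)$, $\mathfrak g=\mathfrak{gl}(n)$, be the $\mathbb C$-algebra generated by $q^{\pm h_{\varepsilon_i}}$ ($1\le i\le n$) and $e_\alpha,f_\alpha$ ($\alpha\in\Pi^+_{\mathfrak g}=\{\alpha_i=\varepsilon_i-\varepsilon_{i+1}\}$) with the usual Drinfeld–Jimbo relations and the comultiplication $\Delta(e_\alpha)=e_\alpha\otimes1+q^{h_\alpha}\otimes e_\alpha$, $\Delta(f_\alpha)=1\otimes f_\alpha+f_\alpha\otimes q^{-h_\alpha}$, $q^{\pm h}$ group-like. Let $U_q(\mathfrak n_-)$ be the subalgebra generated by all $f_\alpha$, let $\mathbb C^n$ be the natural module with standard basis $w_1,\dots,w_n$, and put $[z]_q=\frac{q^z-q^{-z}}{q-q^{-1}}$. A weight $\lambda$ is given by the numbers $q^{(\lambda,\varepsilon_i)}\in\mathbb C^\times$, $1\le i\le n$; $\hat M_\lambda$ is the Verma module with highest weight vector $v_\lambda$, and $\hat V^\lambda_j\subset\mathbb C^n\otimes\hat M_\lambda$ is the $U_q(\mathfrak n_-)$-submodule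 generated by $w_1\otimes v_\lambda,\dots,w_j\otimes v_\lambda$ ($\hat V_0^\lambda=0$). Let $\rho$ be the half-sum of the positive roots, so that $(\rho,\varepsilon_i-\varepsilon_j)=j-i$. The group $S_n$ acts by $\sigma(\varepsilon_i)=\varepsilon_{\sigma(i)}$ and $\sigma\cdot\lambda=\sigma(\lambda+\rho)-\rho$. Define $\check f_{\alpha}=f_\alpha$ for $\alpha\in\Pi^+_{\mathfrak g}$ and recursively, for $\alpha=\alpha_i+\beta$ with $\beta=\varepsilon_{i+1}-\varepsilon_j$, $j>i+1$, $$\check f_\alpha=f_{\alpha_i}\check f_\beta\,[h_\beta+(\rho,\beta)]_q-\check f_\beta f_{\alpha_i}\,[h_\beta+(\rho,\beta)-1]_q .$$ Let $n=n_1+\dots+n_k$ with $n_i\ge1$, let $\mathfrak l=\mathfrak{gl}(n_1)\oplus\dots\oplus\mathfrak{gl}(n_k)\subset\mathfrak g$ be the block diagonal subalgebra with simple roots $\Pi^+_{\mathfrak l}\subset\Pi^+_{\mathfrak g}$, and let $m_i=n_1+\dots+n_{i-1}+1$. Let $\sigma\in S_n$ be admissible: $\sigma(i)<\sigma(j)$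 whenever $i<j$ lie in the same block. Put $I^\sigma_{\mathfrak l}=\sigma(\{m_1,\dots,m_k\})=\{m_1^\sigma<\dots<m_k^\sigma\}$ and $\bar I^\sigma_{\mathfrak l}=[1,n]\setminus I^\sigma_{\mathfrak l}$. Let $\lambda$ be such that $q^{(\lambda,\alpha)}=1$ for all $\alpha\in\Pi^+_{\mathfrak l}$. Let $M_{\sigma\cdot\lambda}$ be the quotient of $\hat M_{\sigma\cdot\lambda}$ by the submodule $\sum_{\alpha\in\Pi^+_{\mathfrak l}}U_q(\mathfrak g)\check f_{\sigma(\alpha)}v_{\sigma\cdot\lambda}$, let $\varpi:\hat M_{\sigma\cdot\lambda}\to M_{\sigma\cdot\lambda}$ be the projection, and put $V_i^{\sigma\cdot\lambda}=(\mathrm{id}\otimes\varpi)(\hat V^{\sigma\cdot\lambda}_{m_i^\sigma})$, $i=1,\dots,k$. Put $\hat x_j=q^{2(\sigma\cdot\lambda,\varepsilon_j)-2j+2}$ and call $\lambda$ *$\sigma$-regular* if $\hat x_j\ne\hat x_m$ whenever $\varepsilon_l-\varepsilon_m\in\sigma(\Pi^+_{\mathfrak l})$ and $l<j<m$. (This holds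 for every $\lambda$ if $\sigma(\Pi^+_{\mathfrak l})\subset\Pi^+_{\mathfrak g}$, and for every $\sigma$ if $q^{2(\lambda,\varepsilon_i)-2i}\neq q^{2(\lambda,\varepsilon_j)-2j}$ for all $i,j$ in different blocks.) 1. If $\lambda$ is $\sigma$-regular, then for all $m\in\bar I^\sigma_{\mathfrak l}$ the graded piece $\hat V^{\sigma\cdot\lambda}_m/\hat V^{\sigma\cdot\lambda}_{m-1}$ is annihilated by $\mathrm{id}\otimes\varpi$, i.e. $(\mathrm{id}\otimes\varpi)(\hat V^{\sigma\cdot\lambda}_m)=(\mathrm{id}\otimes\varpi)(\hat V^{\sigma\cdot\lambda}_{m-1})$. 2. If $\lambda$ is $\sigma$-regular, then $V_1^{\sigma\cdot\lambda}\subset\dots\subset V_k^{\sigma\cdot\lambda}=\mathbb C^n\otimes M_{\sigma\cdot\lambda}$ is a filtration by $U_q(\mathfrak g)$-submodules (inclusions not claimed to be strict). 3. If $\sigma(\Pi^+_{\mathfrak l})\subset\Pi^+_{\mathfrak g}$, then, as a filtration of $U_q(\mathfrak n_-)$-modules, it is independent of $\lambda$: for any two weights $\lambda,\lambda'$ with $q^{(\lambda,\alpha)}=q^{(\lambda',\alpha)}=1$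 for all $\alpha\in\Pi_{\mathfrak l}^+$ there is an isomorphism of $U_q(\mathfrak n_-)$-modules $\mathbb C^n\otimes M_{\sigma\cdot\lambda}\to\mathbb C^n\otimes M_{\sigma\cdot\lambda'}$ that maps $V_i^{\sigma\cdot\lambda}$ onto $V_i^{\sigma\cdot\lambda'}$ for all $i=1,\dots,k$. -/

import Mathlib

open scoped TensorProduct

noncomputable section

namespace QuantumGL

/-! ### The quantum group `U_q(gl(n))`, `n = r + 1`

Indices are 0-based: `ε_1, …, ε_n` are indexed by `Fin (r + 1)`, and the simple root
`α_a = ε_a - ε_{a+1}` is indexed by `a : Fin r`, with `a.castSucc` and `a.succ` the two positions. -/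

/-- Generators: `K i = q^{h_{ε_i}}`, `Kinv i = q^{-h_{ε_i}}`, `e a = e_{α_a}`, `f a = f_{α_a}`. -/
inductive Gen (r : ℕ) : Type
  | K (i : Fin (r + 1)) : Gen r
  | Kinv (i : Fin (r + 1)) : Gen r
  | e (a : Fin r) : Gen r
  | f (a : Fin r) : Gen r

/-- The inner product `(ε_i, α_a)`. -/
def pairing {r : ℕ} (i : Fin (r + 1)) (a : Fin r) : ℤ :=
  (if i = a.castSucc then 1 else 0) - (if i = a.succ then 1 else 0)

/-- `α_a` and `α_b` are neighbours, i.e. `(α_a, α_b) = -1`. -/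
def Neighbours {r : ℕ} (a b : Fin r) : Prop := (a : ℕ) + 1 = b ∨ (b : ℕ) + 1 = a

/-- The `q`-Serre expression `x² y - [2]_q x y x + y x²`. -/
def serre (q : ℂˣ) {A : Type*} [Ring A] [Algebra ℂ A] (x y : A) : A :=
  x * x * y - ((q : ℂ) + (q : ℂ)⁻¹) • (x * y * x) + y * x * x

open FreeAlgebra in
/-- The defining relations of `U_q(gl(r + 1))`. The commutator `[e_α, f_α]` is written with the
denominator `q - q⁻¹` cleared, which is equivalent as soon as `q² ≠ 1`. -/
inductive Rel (r : ℕ) (q : ℂˣ) : FreeAlgebra ℂ (Gen r) → FreeAlgebra ℂ (Gen r) → Prop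
  | K_Kinv (i) : Rel r q (ι ℂ (.K i) * ι ℂ (.Kinv i)) 1
  | Kinv_K (i) : Rel r q (ι ℂ (.Kinv i) * ι ℂ (.K i)) 1
  | K_K (i j) : Rel r q (ι ℂ (.K i) * ι ℂ (.K j)) (ι ℂ (.K j) * ι ℂ (.K i))
  | K_e (i a) : Rel r q (ι ℂ (.K i) * ι ℂ (.e a))
      ((q : ℂ) ^ pairing i a • (ι ℂ (.e a) * ι ℂ (.K i)))
  | K_f (i a) : Rel r q (ι ℂ (.K i) * ι ℂ (.f a))
      ((q : ℂ) ^ (-pairing i a) • (ι ℂ (.f a) * ι ℂ (.K i)))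
  | e_f_self (a) : Rel r q
      (((q : ℂ) - (q : ℂ)⁻¹) • (ι ℂ (.e a) * ι ℂ (.f a) - ι ℂ (.f a) * ι ℂ (.e a)))
      (ι ℂ (.K a.castSucc) * ι ℂ (.Kinv a.succ) - ι ℂ (.Kinv a.castSucc) * ι ℂ (.K a.succ))
  | e_f_ne (a b) (h : a ≠ b) : Rel r q (ι ℂ (.e a) * ι ℂ (.f b)) (ι ℂ (.f b) * ι ℂ (.e a))
  | e_serre (a b) (h : Neighbours a b) : Rel r q (serre q (ι ℂ (.e a)) (ι ℂ (.e b))) 0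
  | f_serre (a b) (h : Neighbours a b) : Rel r q (serre q (ι ℂ (.f a)) (ι ℂ (.f b))) 0
  | e_e (a b : Fin r) (h : (a : ℕ) + 1 < b) : Rel r q (ι ℂ (.e a) * ι ℂ (.e b)) (ι ℂ (.e b) * ι ℂ (.e a))
  | f_f (a b : Fin r) (h : (a : ℕ) + 1 < b) : Rel r q (ι ℂ (.f a) * ι ℂ (.f b)) (ι ℂ (.f b) * ι ℂ (.f a))

/-- The quantum group `U_q(gl(r + 1))` as an algebra over `ℂ`. -/
def Uq (r : ℕ) (q : ℂˣ) : Type := RingQuot (Rel r q)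

instance (r : ℕ) (q : ℂˣ) : Ring (Uq r q) := inferInstanceAs (Ring (RingQuot (Rel r q)))
instance (r : ℕ) (q : ℂˣ) : Algebra ℂ (Uq r q) :=
  inferInstanceAs (Algebra ℂ (RingQuot (Rel r q)))

variable {r : ℕ} {q : ℂˣ}

/-- The quotient map from the free algebra. -/
def proj (r : ℕ) (q : ℂˣ) : FreeAlgebra ℂ (Gen r) →ₐ[ℂ] Uq r q := RingQuot.mkAlgHom ℂ (Rel r q)

lemma proj_rel {x y : FreeAlgebra ℂ (Gen r)} (h : Rel r q x y) : proj r q x = proj r q y :=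
  RingQuot.mkAlgHom_rel ℂ h

/-- The image of a generator in `U_q(gl(r + 1))`. -/
def gen (q : ℂˣ) (g : Gen r) : Uq r q := proj r q (FreeAlgebra.ι ℂ g)

/-- `q^{h_{ε_i}}` -/
abbrev K (q : ℂˣ) (i : Fin (r + 1)) : Uq r q := gen q (.K i)
/-- `q^{-h_{ε_i}}` -/
abbrev Kinv (q : ℂˣ) (i : Fin (r + 1)) : Uq r q := gen q (.Kinv i)
/-- `e_{α_a}` -/
abbrev e (q : ℂˣ) (a : Fin r) : Uq r q := gen q (.e a)
/-- `f_{α_a}` -/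
abbrev f (q : ℂˣ) (a : Fin r) : Uq r q := gen q (.f a)
/-- `q^{h_{α_a}}` -/
def k (q : ℂˣ) (a : Fin r) : Uq r q := K q a.castSucc * Kinv q a.succ
/-- `q^{-h_{α_a}}` -/
def kinv (q : ℂˣ) (a : Fin r) : Uq r q := Kinv q a.castSucc * K q a.succ

lemma K_mul_Kinv (i : Fin (r + 1)) : K q i * Kinv q i = 1 := by
  simpa [gen] using proj_rel (Rel.K_Kinv (q := q) i)
lemma Kinv_mul_K (i : Fin (r + 1)) : Kinv q i * K q i = 1 := by
  simpa [gen] using proj_rel (Rel.Kinv_K (q := q) i)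
lemma K_mul_K (i j : Fin (r + 1)) : K q i * K q j = K q j * K q i := by
  simpa [gen] using proj_rel (Rel.K_K (q := q) i j)
lemma K_mul_e (i : Fin (r + 1)) (a : Fin r) :
    K q i * e q a = (q : ℂ) ^ pairing i a • (e q a * K q i) := by
  simpa [gen] using proj_rel (Rel.K_e (q := q) i a)
lemma K_mul_f (i : Fin (r + 1)) (a : Fin r) :
    K q i * f q a = (q : ℂ) ^ (-pairing i a) • (f q a * K q i) := by
  simpa [gen, -zpow_neg] using proj_rel (Rel.K_f (q := q) i a)
lemma e_f_self (a : Fin r) :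
    ((q : ℂ) - (q : ℂ)⁻¹) • (e q a * f q a - f q a * e q a) = k q a - kinv q a := by
  simpa only [gen, k, kinv, map_smul, map_sub, map_mul] using
    proj_rel (Rel.e_f_self (q := q) a)
lemma e_f_ne {a b : Fin r} (h : a ≠ b) : e q a * f q b = f q b * e q a := by
  simpa [gen] using proj_rel (Rel.e_f_ne (q := q) a b h)
lemma e_serre {a b : Fin r} (h : Neighbours a b) : serre q (e q a) (e q b) = 0 := by
  simpa only [gen, serre, map_smul, map_sub, map_mul, map_add, map_zero] using
    proj_rel (Rel.e_serre (q := q) a b h)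
lemma f_serre {a b : Fin r} (h : Neighbours a b) : serre q (f q a) (f q b) = 0 := by
  simpa only [gen, serre, map_smul, map_sub, map_mul, map_add, map_zero] using
    proj_rel (Rel.f_serre (q := q) a b h)
lemma e_e {a b : Fin r} (h : (a : ℕ) + 1 < b) : e q a * e q b = e q b * e q a := by
  simpa [gen] using proj_rel (Rel.e_e (q := q) a b h)
lemma f_f {a b : Fin r} (h : (a : ℕ) + 1 < b) : f q a * f q b = f q b * f q a := by
  simpa [gen] using proj_rel (Rel.f_f (q := q) a b h)

/-- Algebra maps out of `U_q(gl(r + 1))` from images of the generators. -/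
def lift {A : Type*} [Ring A] [Algebra ℂ A] (φ : Gen r → A)
    (h : ∀ ⦃x y⦄, Rel r q x y → FreeAlgebra.lift ℂ φ x = FreeAlgebra.lift ℂ φ y) :
    Uq r q →ₐ[ℂ] A :=
  RingQuot.liftAlgHom ℂ ⟨FreeAlgebra.lift ℂ φ, h⟩

lemma lift_gen {A : Type*} [Ring A] [Algebra ℂ A] (φ : Gen r → A)
    (h : ∀ ⦃x y⦄, Rel r q x y → FreeAlgebra.lift ℂ φ x = FreeAlgebra.lift ℂ φ y) (g : Gen r) :
    lift φ h (gen q g) = φ g := by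
  have h1 := RingQuot.liftAlgHom_mkAlgHom_apply ℂ (FreeAlgebra.lift ℂ φ) h (FreeAlgebra.ι ℂ g)
  exact h1.trans (by simp)

/-! ### The comultiplication -/

/-- Values of the comultiplication on generators. -/
def comulGen (q : ℂˣ) : Gen r → Uq r q ⊗[ℂ] Uq r q
  | .K i => K q i ⊗ₜ K q i
  | .Kinv i => Kinv q i ⊗ₜ Kinv q i
  | .e a => e q a ⊗ₜ 1 + k q a ⊗ₜ e q a
  | .f a => 1 ⊗ₜ f q a + f q a ⊗ₜ kinv q a

/-- `(α_a, α_b)` -/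
def cartan (a b : Fin r) : ℤ := pairing a.castSucc b - pairing a.succ b

lemma cartan_self (a : Fin r) : cartan a a = 2 := by
  simp [cartan, pairing, Fin.ext_iff]
lemma cartan_neighbours {a b : Fin r} (h : Neighbours a b) : cartan a b = -1 := by
  unfold Neighbours at h
  simp only [cartan, pairing, Fin.ext_iff, Fin.val_castSucc, Fin.val_succ]
  split_ifs <;> omega
lemma cartan_far {a b : Fin r} (h : (a : ℕ) + 1 < b) : cartan a b = 0 := by
  simp only [cartan, pairing, Fin.ext_iff, Fin.val_castSucc, Fin.val_succ]
  split_ifs <;> omega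
lemma cartan_symm (a b : Fin r) : cartan a b = cartan b a := by
  simp only [cartan, pairing, Fin.ext_iff, Fin.val_castSucc, Fin.val_succ]
  split_ifs <;> omega

lemma comm_inv {A : Type*} [Ring A] [Algebra ℂ A] {x y z : A} {c : ℂ} (hc : c ≠ 0)
    (h₁ : x * y = 1) (h₂ : y * x = 1) (h : x * z = c • (z * x)) : y * z = c⁻¹ • (z * y) := by
  have : y * (x * z) * y = c • (y * (z * x) * y) := by rw [h]; simp
  rw [← mul_assoc, h₂, one_mul] at this
  rw [this, ← mul_assoc, mul_assoc _ x y, h₁, mul_one, smul_smul, inv_mul_cancel₀ hc, one_smul]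

lemma Kinv_mul_e (i : Fin (r + 1)) (a : Fin r) :
    Kinv q i * e q a = (q : ℂ) ^ (-pairing i a) • (e q a * Kinv q i) := by
  rw [comm_inv (zpow_ne_zero _ q.ne_zero) (K_mul_Kinv i) (Kinv_mul_K i) (K_mul_e i a), zpow_neg]
lemma Kinv_mul_f (i : Fin (r + 1)) (a : Fin r) :
    Kinv q i * f q a = (q : ℂ) ^ (pairing i a) • (f q a * Kinv q i) := by
  rw [comm_inv (zpow_ne_zero _ q.ne_zero) (K_mul_Kinv i) (Kinv_mul_K i) (K_mul_f i a), zpow_neg,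
    inv_inv]
lemma Kinv_mul_K' (i j : Fin (r + 1)) : Kinv q i * K q j = K q j * Kinv q i := by
  simpa using comm_inv (c := 1) one_ne_zero (K_mul_Kinv (q := q) i) (Kinv_mul_K i)
    (z := K q j) (by simpa using K_mul_K i j)
lemma Kinv_mul_Kinv (i j : Fin (r + 1)) : Kinv q i * Kinv q j = Kinv q j * Kinv q i := by
  simpa using comm_inv (c := 1) one_ne_zero (K_mul_Kinv (q := q) i) (Kinv_mul_K i)
    (z := Kinv q j) (by simpa using (Kinv_mul_K' j i).symm)

lemma k_mul_e (a b : Fin r) : k q a * e q b = (q : ℂ) ^ cartan a b • (e q b * k q a) := by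
  rw [k, mul_assoc, Kinv_mul_e, mul_smul_comm, ← mul_assoc, K_mul_e, smul_mul_assoc, smul_smul,
    ← zpow_add₀ q.ne_zero, mul_assoc, cartan]
  congr 2; ring
lemma k_mul_f (a b : Fin r) : k q a * f q b = (q : ℂ) ^ (-cartan a b) • (f q b * k q a) := by
  rw [k, mul_assoc, Kinv_mul_f, mul_smul_comm, ← mul_assoc, K_mul_f, smul_mul_assoc, smul_smul,
    ← zpow_add₀ q.ne_zero, mul_assoc, cartan]
  congr 2; ring
lemma kinv_mul_e (a b : Fin r) : kinv q a * e q b = (q : ℂ) ^ (-cartan a b) • (e q b * kinv q a) := by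
  rw [kinv, mul_assoc, K_mul_e, mul_smul_comm, ← mul_assoc, Kinv_mul_e, smul_mul_assoc, smul_smul,
    ← zpow_add₀ q.ne_zero, mul_assoc, cartan]
  congr 2; ring
lemma kinv_mul_f (a b : Fin r) : kinv q a * f q b = (q : ℂ) ^ (cartan a b) • (f q b * kinv q a) := by
  rw [kinv, mul_assoc, K_mul_f, mul_smul_comm, ← mul_assoc, Kinv_mul_f, smul_mul_assoc, smul_smul,
    ← zpow_add₀ q.ne_zero, mul_assoc, cartan]
  congr 2; ring
lemma K_mul_k (i : Fin (r + 1)) (a : Fin r) : K q i * k q a = k q a * K q i := by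
  rw [k, ← mul_assoc, K_mul_K, mul_assoc, ← Kinv_mul_K', mul_assoc]
lemma K_mul_kinv (i : Fin (r + 1)) (a : Fin r) : K q i * kinv q a = kinv q a * K q i := by
  rw [kinv, ← mul_assoc, ← Kinv_mul_K', mul_assoc, K_mul_K, mul_assoc]
lemma Kinv_mul_k (i : Fin (r + 1)) (a : Fin r) : Kinv q i * k q a = k q a * Kinv q i := by
  rw [k, ← mul_assoc, Kinv_mul_K', mul_assoc, Kinv_mul_Kinv, mul_assoc]
lemma Kinv_mul_kinv (i : Fin (r + 1)) (a : Fin r) : Kinv q i * kinv q a = kinv q a * Kinv q i := by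
  rw [kinv, ← mul_assoc, Kinv_mul_Kinv, mul_assoc, Kinv_mul_K', mul_assoc]
lemma k_mul_k (a b : Fin r) : k q a * k q b = k q b * k q a := by
  conv_lhs => rw [k, mul_assoc, Kinv_mul_k, ← mul_assoc, K_mul_k, mul_assoc]
  rfl
lemma kinv_mul_kinv (a b : Fin r) : kinv q a * kinv q b = kinv q b * kinv q a := by
  conv_lhs => rw [kinv, mul_assoc, K_mul_kinv, ← mul_assoc, Kinv_mul_kinv, mul_assoc]
  rfl

lemma serre_add {A : Type*} [Ring A] [Algebra ℂ A] {x y x' y' : A}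
    (h₁ : y * x = (q : ℂ) ^ (2 : ℤ) • (x * y)) (h₂ : y * x' = (q : ℂ) ^ (-1 : ℤ) • (x' * y))
    (h₃ : y' * x = (q : ℂ) ^ (-1 : ℤ) • (x * y'))
    (hx : serre q x x' = 0) (hy : serre q y y' = 0) : serre q (x + y) (x' + y') = 0 := by
  have hq : (q : ℂ) ≠ 0 := q.ne_zero
  have h₁' (z : A) : y * (x * z) = (q : ℂ) ^ (2 : ℤ) • (x * (y * z)) := by
    rw [← mul_assoc, h₁, smul_mul_assoc, mul_assoc]
  have h₂' (z : A) : y * (x' * z) = (q : ℂ) ^ (-1 : ℤ) • (x' * (y * z)) := by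
    rw [← mul_assoc, h₂, smul_mul_assoc, mul_assoc]
  have h₃' (z : A) : y' * (x * z) = (q : ℂ) ^ (-1 : ℤ) • (x * (y' * z)) := by
    rw [← mul_assoc, h₃, smul_mul_assoc, mul_assoc]
  rw [← add_zero (0 : A)]
  nth_rewrite 1 [← hx]
  rw [← hy]
  simp only [serre, mul_add, add_mul, mul_assoc, h₁, h₂, h₃, h₁', h₂', h₃', mul_smul_comm,
    smul_mul_assoc, smul_add, smul_smul]
  match_scalars <;> field_simp <;> ring

lemma comul_rel ⦃x y : FreeAlgebra ℂ (Gen r)⦄ (h : Rel r q x y) :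
    FreeAlgebra.lift ℂ (comulGen q) x = FreeAlgebra.lift ℂ (comulGen q) y := by
  have hq : (q : ℂ) ≠ 0 := q.ne_zero
  induction h with
  | K_Kinv i => simp [comulGen, K_mul_Kinv, Algebra.TensorProduct.one_def]
  | Kinv_K i => simp [comulGen, Kinv_mul_K, Algebra.TensorProduct.one_def]
  | K_K i j => simp [comulGen, K_mul_K i j]
  | K_e i a =>
    simp [comulGen, mul_add, add_mul, K_mul_e i a, K_mul_k, TensorProduct.smul_tmul']
  | K_f i a =>
    simp [comulGen, mul_add, add_mul, K_mul_f i a, K_mul_kinv, TensorProduct.smul_tmul']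
  | e_f_self a =>
    simp only [map_smul, map_sub, map_mul, FreeAlgebra.lift_ι_apply, comulGen, mul_add, add_mul,
      Algebra.TensorProduct.tmul_mul_tmul, one_mul, mul_one, k_mul_f, kinv_mul_e,
      TensorProduct.tmul_smul, ← TensorProduct.smul_tmul']
    have := e_f_self (q := q) a
    have h1 : ((q : ℂ) - (q : ℂ)⁻¹) • ((e q a * f q a - f q a * e q a) ⊗ₜ[ℂ] kinv q a) =
      (k q a - kinv q a) ⊗ₜ kinv q a := by rw [TensorProduct.smul_tmul', this]
    have h2 : ((q : ℂ) - (q : ℂ)⁻¹) • (k q a ⊗ₜ[ℂ] (e q a * f q a - f q a * e q a)) =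
      k q a ⊗ₜ (k q a - kinv q a) := by rw [← TensorProduct.tmul_smul, this]
    have h3 : K q a.castSucc * Kinv q a.succ = k q a := rfl
    have h4 : Kinv q a.castSucc * K q a.succ = kinv q a := rfl
    rw [h3, h4]
    simp only [TensorProduct.sub_tmul, TensorProduct.tmul_sub] at h1 h2
    rw [smul_sub] at h1 h2
    simp only [smul_sub, smul_add] at h1 h2 ⊢
    have h5 := congrArg₂ (· + ·) h1 h2
    rw [← sub_eq_zero] at h5 ⊢
    rw [← h5]
    abel
  | e_f_ne a b h =>
    simp only [map_mul, FreeAlgebra.lift_ι_apply, comulGen, mul_add, add_mul,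
      Algebra.TensorProduct.tmul_mul_tmul, one_mul, mul_one, k_mul_f, kinv_mul_e, e_f_ne h,
      TensorProduct.tmul_smul, ← TensorProduct.smul_tmul', cartan_symm b a]
    abel
  | e_serre a b h =>
    have : serre q (comulGen q (.e a)) (comulGen q (.e b)) = 0 := by
      refine serre_add ?_ ?_ ?_ ?_ ?_
      · simp [k_mul_e, cartan_self, TensorProduct.smul_tmul']
      · simp [k_mul_e, cartan_neighbours h, TensorProduct.smul_tmul']
      · simp [k_mul_e, cartan_symm b a, cartan_neighbours h, TensorProduct.smul_tmul']
      · have := congrArg (fun z => z ⊗ₜ[ℂ] (1 : Uq r q)) (e_serre (q := q) h)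
        simpa [serre, TensorProduct.add_tmul, TensorProduct.sub_tmul,
          TensorProduct.smul_tmul'] using this
      · have := congrArg (fun z => (k q a * k q a * k q b) ⊗ₜ[ℂ] z) (e_serre (q := q) h)
        have h1 : k q a * k q b * k q a = k q a * k q a * k q b := by
          rw [mul_assoc, k_mul_k b, mul_assoc]
        have h2 : k q b * k q a * k q a = k q a * k q a * k q b := by
          rw [k_mul_k b, h1]
        simpa [serre, TensorProduct.tmul_add, TensorProduct.tmul_sub, h1, h2] using this
    simpa [serre] using this
  | f_serre a b h =>
    have : serre q (comulGen q (.f a)) (comulGen q (.f b)) = 0 := by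
      refine serre_add ?_ ?_ ?_ ?_ ?_
      · simp [kinv_mul_f, cartan_self]
      · simp [kinv_mul_f, cartan_neighbours h]
      · simp [kinv_mul_f, cartan_symm b a, cartan_neighbours h]
      · have := congrArg (fun z => (1 : Uq r q) ⊗ₜ[ℂ] z) (f_serre (q := q) h)
        simpa [serre, TensorProduct.tmul_add, TensorProduct.tmul_sub] using this
      · have := congrArg (fun z => z ⊗ₜ[ℂ] (kinv q a * kinv q a * kinv q b)) (f_serre (q := q) h)
        have h1 : kinv q a * kinv q b * kinv q a = kinv q a * kinv q a * kinv q b := by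
          rw [mul_assoc, kinv_mul_kinv b, mul_assoc]
        have h2 : kinv q b * kinv q a * kinv q a = kinv q a * kinv q a * kinv q b := by
          rw [kinv_mul_kinv b, h1]
        simpa [serre, TensorProduct.add_tmul, TensorProduct.sub_tmul, h1, h2,
          TensorProduct.smul_tmul'] using this
    simpa [serre] using this
  | e_e a b h =>
    simp only [map_mul, FreeAlgebra.lift_ι_apply, comulGen, mul_add, add_mul,
      Algebra.TensorProduct.tmul_mul_tmul, one_mul, mul_one, k_mul_e, e_e h, k_mul_k a b,
      cartan_symm b a, cartan_far h, zpow_zero, one_smul]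
    abel
  | f_f a b h =>
    simp only [map_mul, FreeAlgebra.lift_ι_apply, comulGen, mul_add, add_mul,
      Algebra.TensorProduct.tmul_mul_tmul, one_mul, mul_one, kinv_mul_f, f_f h, kinv_mul_kinv a b,
      cartan_symm b a, cartan_far h, zpow_zero, one_smul]
    abel

/-- The comultiplication: `Δ(e_α) = e_α ⊗ 1 + q^{h_α} ⊗ e_α`, `Δ(f_α) = 1 ⊗ f_α + f_α ⊗ q^{-h_α}`,
and `q^{± h_ε}` are group-like. -/
def comul (r : ℕ) (q : ℂˣ) : Uq r q →ₐ[ℂ] Uq r q ⊗[ℂ] Uq r q := lift (comulGen q) comul_rel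

/-! ### The natural representation -/

/-- Values of the natural representation on generators:
`q^{h_{ε_i}} ↦ diag(1, …, q, …, 1)`, `e_{α_a} ↦ e_{a, a+1}`, `f_{α_a} ↦ e_{a+1, a}`. -/
def natGen (q : ℂˣ) : Gen r → Matrix (Fin (r + 1)) (Fin (r + 1)) ℂ
  | .K i => Matrix.diagonal fun j => if j = i then (q : ℂ) else 1
  | .Kinv i => Matrix.diagonal fun j => if j = i then (q : ℂ)⁻¹ else 1
  | .e a => Matrix.single a.castSucc a.succ 1
  | .f a => Matrix.single a.succ a.castSucc 1

lemma nat_rel ⦃x y : FreeAlgebra ℂ (Gen r)⦄ (h : Rel r q x y) :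
    FreeAlgebra.lift ℂ (natGen q) x = FreeAlgebra.lift ℂ (natGen q) y := by
  have hq : (q : ℂ) ≠ 0 := q.ne_zero
  have key (a : Fin r) : a.castSucc ≠ a.succ := a.castSucc_lt_succ.ne
  induction h with
  | K_Kinv i =>
    simp only [map_mul, map_one, FreeAlgebra.lift_ι_apply, natGen, Matrix.diagonal_mul_diagonal]
    rw [← Matrix.diagonal_one]
    congr 1; ext j; split_ifs <;> simp
  | Kinv_K i =>
    simp only [map_mul, map_one, FreeAlgebra.lift_ι_apply, natGen, Matrix.diagonal_mul_diagonal]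
    rw [← Matrix.diagonal_one]
    congr 1; ext j; split_ifs <;> simp
  | K_K i j =>
    simp only [map_mul, FreeAlgebra.lift_ι_apply, natGen, Matrix.diagonal_mul_diagonal, mul_comm]
  | K_e i a =>
    simp only [map_mul, map_smul, FreeAlgebra.lift_ι_apply, natGen]
    ext x y
    simp only [Matrix.diagonal_mul, Matrix.smul_apply, Matrix.mul_diagonal, Matrix.single_apply,
      pairing, smul_eq_mul]
    by_cases hxy : a.castSucc = x ∧ a.succ = y
    · obtain ⟨rfl, rfl⟩ := hxy
      simp only [and_self, if_true, mul_one, one_mul]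
      have := key a
      by_cases h1 : i = a.castSucc
      · subst h1; simp [this, this.symm]
      by_cases h2 : i = a.succ
      · subst h2; simp [this, this.symm]
      simp [h1, h2, Ne.symm h1, Ne.symm h2]
    · simp [hxy]
  | K_f i a =>
    simp only [map_mul, map_smul, FreeAlgebra.lift_ι_apply, natGen]
    ext x y
    simp only [Matrix.diagonal_mul, Matrix.smul_apply, Matrix.mul_diagonal, Matrix.single_apply,
      pairing, smul_eq_mul]
    by_cases hxy : a.succ = x ∧ a.castSucc = y
    · obtain ⟨rfl, rfl⟩ := hxy
      simp only [and_self, if_true, mul_one, one_mul]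
      have := key a
      by_cases h1 : i = a.castSucc
      · subst h1; simp [this, this.symm]
      by_cases h2 : i = a.succ
      · subst h2; simp [this, this.symm]
      simp [h1, h2, Ne.symm h1, Ne.symm h2]
    · simp [hxy]
  | e_f_self a =>
    simp only [map_mul, map_smul, map_sub, FreeAlgebra.lift_ι_apply, natGen,
      Matrix.diagonal_mul_diagonal]
    ext x y
    simp only [Matrix.single_mul_single_same, Matrix.smul_apply, Matrix.sub_apply,
      Matrix.diagonal_apply, Matrix.single_apply, smul_eq_mul]
    grind
  | e_f_ne a b h =>
    have h' : b ≠ a := h.symm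
    simp [natGen, h, h', Matrix.single_mul_single_of_ne]
  | e_serre a b h =>
    unfold Neighbours at h
    have h1 : b.succ ≠ a.castSucc ∨ a.succ ≠ b.castSucc := by
      simp only [ne_eq, Fin.ext_iff, Fin.val_castSucc, Fin.val_succ]; omega
    have h0 : natGen q (.e a) * natGen q (.e a) = 0 :=
      Matrix.single_mul_single_of_ne _ _ _ _ (key a).symm _
    have h2 : natGen q (.e a) * natGen q (.e b) * natGen q (.e a) = 0 := by
      rcases h1 with h1 | h1
      · rw [mul_assoc, natGen, natGen, Matrix.single_mul_single_of_ne (h := h1), mul_zero]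
      · rw [natGen, natGen, Matrix.single_mul_single_of_ne (h := h1), zero_mul]
    simp only [serre, map_add, map_sub, map_mul, map_smul, map_zero, FreeAlgebra.lift_ι_apply]
    rw [h2, h0, mul_assoc _ (natGen q (.e a)), h0]
    simp
  | f_serre a b h =>
    unfold Neighbours at h
    have h1 : b.castSucc ≠ a.succ ∨ a.castSucc ≠ b.succ := by
      simp only [ne_eq, Fin.ext_iff, Fin.val_castSucc, Fin.val_succ]; omega
    have h0 : natGen q (.f a) * natGen q (.f a) = 0 :=
      Matrix.single_mul_single_of_ne _ _ _ _ (key a) _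
    have h2 : natGen q (.f a) * natGen q (.f b) * natGen q (.f a) = 0 := by
      rcases h1 with h1 | h1
      · rw [mul_assoc, natGen, natGen, Matrix.single_mul_single_of_ne (h := h1), mul_zero]
      · rw [natGen, natGen, Matrix.single_mul_single_of_ne (h := h1), zero_mul]
    simp only [serre, map_add, map_sub, map_mul, map_smul, map_zero, FreeAlgebra.lift_ι_apply]
    rw [h2, h0, mul_assoc _ (natGen q (.f a)), h0]
    simp
  | e_e a b h =>
    have h1 : a.succ ≠ b.castSucc := by
      simp only [ne_eq, Fin.ext_iff, Fin.val_castSucc, Fin.val_succ]; omega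
    have h2 : b.succ ≠ a.castSucc := by
      simp only [ne_eq, Fin.ext_iff, Fin.val_castSucc, Fin.val_succ]; omega
    simp [natGen, Matrix.single_mul_single_of_ne, h1, h2]
  | f_f a b h =>
    have h1 : a.castSucc ≠ b.succ := by
      simp only [ne_eq, Fin.ext_iff, Fin.val_castSucc, Fin.val_succ]; omega
    have h2 : b.castSucc ≠ a.succ := by
      simp only [ne_eq, Fin.ext_iff, Fin.val_castSucc, Fin.val_succ]; omega
    simp [natGen, Matrix.single_mul_single_of_ne, h1, h2]

/-- The natural representation `π` of `U_q(gl(r + 1))` on `ℂ^{r + 1}`. -/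
def natRep (r : ℕ) (q : ℂˣ) : Uq r q →ₐ[ℂ] Module.End ℂ (Fin (r + 1) → ℂ) :=
  (Matrix.toLinAlgEquiv' : _ ≃ₐ[ℂ] _).toAlgHom.comp (lift (natGen q) nat_rel)

/-- The action of `U_q(gl(r + 1))` on `ℂ^{r + 1} ⊗ M`, for a `U_q(gl(r + 1))`-module `M`, through
the comultiplication. -/
def tensorRep (r : ℕ) (q : ℂˣ) (M : Type) [AddCommGroup M] [Module ℂ M] [Module (Uq r q) M]
    [IsScalarTower ℂ (Uq r q) M] : Uq r q →ₐ[ℂ] Module.End ℂ ((Fin (r + 1) → ℂ) ⊗[ℂ] M) :=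
  (Module.endTensorEndAlgHom (R := ℂ) (A := ℂ)).comp
    ((Algebra.TensorProduct.map (natRep r q) (Algebra.lsmul ℂ ℂ M)).comp (comul r q))

/-- `U_q(n_-)`, the subalgebra generated by all `f_α`. -/
def nMinus (r : ℕ) (q : ℂˣ) : Subalgebra ℂ (Uq r q) := Algebra.adjoin ℂ (Set.range (f q))

/-! ### Dynamical root vectors -/

/-- The element `[h_β + m]_q` of `U_q(h)` for `β = ε_i - ε_j`. -/
def qBracket (q : ℂˣ) (i j : Fin (r + 1)) (m : ℤ) : Uq r q :=
  ((q : ℂ) - (q : ℂ)⁻¹)⁻¹ •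
    ((q : ℂ) ^ m • (K q i * Kinv q j) - (q : ℂ) ^ (-m) • (Kinv q i * K q j))

/-- The dynamical root vector attached to `α = ε_i - ε_j`, `i < j` (and `0` if `j ≤ i`): it is
`f_α` if `α` is simple; otherwise `α = α_a + β` with `α_a = ε_i - ε_{i+1}`, `β = ε_{i+1} - ε_j`,
`(ρ, β) = j - i - 1`, and it is obtained by recursion from the vector attached to `β`. -/
def dynRoot (q : ℂˣ) (i j : Fin (r + 1)) : Uq r q :=
  if h : i < j then
    let a : Fin r := ⟨i, by omega⟩
    if a.succ = j then f q a
    else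
      f q a * dynRoot q a.succ j * qBracket q a.succ j ((j : ℤ) - i - 1)
        - dynRoot q a.succ j * f q a * qBracket q a.succ j ((j : ℤ) - i - 1 - 1)
  else 0
termination_by (j : ℕ) - i
decreasing_by all_goals (simp only [Fin.val_succ]; omega)

/-! ### Weights and Verma modules -/

/-- A weight `λ` of `U_q(h)`, given by the numbers `q^{(λ, ε_i)} ∈ ℂˣ`. -/
abbrev Weight (r : ℕ) : Type := Fin (r + 1) → ℂˣ

/-- The shifted action `σ · λ = σ(λ + ρ) - ρ` of the symmetric group, where `(ρ, ε_i - ε_j) = j - i`: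
`(σ · λ, ε_i) = (λ, ε_j) + (i - j)` for `j = σ⁻¹ i`. -/
def dot (q : ℂˣ) (σ : Equiv.Perm (Fin (r + 1))) (lam : Weight r) : Weight r :=
  fun i => lam (σ⁻¹ i) * q ^ ((i : ℤ) - (σ⁻¹ i : Fin (r + 1)))

/-- The left ideal of `U_q` generated by all `e_α` and all `q^{h_{ε_i}} - q^{(λ, ε_i)}`. -/
def vermaIdeal (q : ℂˣ) (lam : Weight r) : Submodule (Uq r q) (Uq r q) :=
  Submodule.span (Uq r q)
    (Set.range (e q) ∪ Set.range fun i => K q i - algebraMap ℂ (Uq r q) (lam i))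

/-- The Verma module of highest weight `λ`, induced from the character of `U_q(b_+)` given by `λ`. -/
abbrev Verma (q : ℂˣ) (lam : Weight r) : Type := Uq r q ⧸ vermaIdeal q lam

/-- The highest weight vector of the Verma module. -/
def vermaVec (q : ℂˣ) (lam : Weight r) : Verma q lam := (vermaIdeal q lam).mkQ 1

/-- The `U_q(n_-)`-submodule of `ℂ^n ⊗ Verma λ` generated by `w_i ⊗ v_λ` for the first `j` basis
vectors `w_i` (as a subspace). -/
def Vhat (q : ℂˣ) (lam : Weight r) (j : ℕ) :
    Submodule ℂ ((Fin (r + 1) → ℂ) ⊗[ℂ] Verma q lam) :=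
  Submodule.span ℂ {x | ∃ y ∈ nMinus r q, ∃ i : Fin (r + 1), (i : ℕ) < j ∧
    x = tensorRep r q (Verma q lam) y (Pi.single i 1 ⊗ₜ vermaVec q lam)}

/-! ### The Levi subalgebra `l = gl(n_1) ⊕ … ⊕ gl(n_k)` attached to a composition of `n` -/

/-- The simple roots of `l`. -/
def leviRoots (c : Composition (r + 1)) : Set (Fin r) :=
  {a | c.index a.castSucc = c.index a.succ}

/-- `λ` is orthogonal to all (simple) roots of `l`. -/
def IsCentral (c : Composition (r + 1)) (lam : Weight r) : Prop :=
  ∀ a ∈ leviRoots c, lam a.castSucc = lam a.succ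

/-- `σ(i) < σ(j)` whenever `i < j` lie in the same block. -/
def Admissible (c : Composition (r + 1)) (σ : Equiv.Perm (Fin (r + 1))) : Prop :=
  ∀ i j, c.index i = c.index j → i < j → σ i < σ j

/-- `σ` maps simple roots of `l` to simple roots of `gl(n)`. -/
def MapsSimpleToSimple (c : Composition (r + 1)) (σ : Equiv.Perm (Fin (r + 1))) : Prop :=
  ∀ a ∈ leviRoots c, ∃ b : Fin r, σ a.castSucc = b.castSucc ∧ σ a.succ = b.succ

/-- `σ(I_l)`, where `I_l` is the set of the first positions of the blocks. -/
def leadSet (c : Composition (r + 1)) (σ : Equiv.Perm (Fin (r + 1))) : Finset (Fin (r + 1)) :=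
  Finset.univ.image fun i : Fin c.length => σ (c.embedding i ⟨0, c.one_le_blocksFun i⟩)

lemma card_leadSet (c : Composition (r + 1)) (σ : Equiv.Perm (Fin (r + 1))) :
    (leadSet c σ).card = c.length := by
  rw [leadSet, Finset.card_image_of_injective _ fun i j h => ?_, Finset.card_univ, Fintype.card_fin]
  have := congrArg c.index (σ.injective h)
  simpa using this

/-- The elements `m_1^σ < … < m_k^σ` of `σ(I_l)` in increasing order. -/
def mSigma (c : Composition (r + 1)) (σ : Equiv.Perm (Fin (r + 1))) :
    Fin c.length ↪o Fin (r + 1) :=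
  (leadSet c σ).orderEmbOfFin (card_leadSet c σ)

/-- The eigenvalue `q^{2(λ, ε_i) - 2 i + 2}` (`i` counted from `1`) attached to `λ`. -/
def xhat (q : ℂˣ) (lam : Weight r) (i : Fin (r + 1)) : ℂˣ := lam i ^ 2 * q ^ (-2 * (i : ℤ))

/-- Regularity of `λ` relative to `σ`: whenever `ε_l - ε_m = σ(α)` for a simple root `α` of `l` and
`l < j < m`, the eigenvalues number `j` and `m` attached to `σ · λ` differ, i.e.
`q^{2(σ · λ + ρ, ν)} ≠ 1` for all positive roots `ν` such that `σ(α) - ν` is a positive root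
with the same left end as `σ(α)`. It is void if every `σ(α)` is a simple root. -/
def Regular (q : ℂˣ) (c : Composition (r + 1)) (σ : Equiv.Perm (Fin (r + 1))) (lam : Weight r) :
    Prop :=
  ∀ a ∈ leviRoots c, ∀ j, σ a.castSucc < j → j < σ a.succ →
    xhat q (dot q σ lam) j ≠ xhat q (dot q σ lam) (σ a.succ)

/-! ### The module `M_{σ · λ}` and the filtration of `ℂ^n ⊗ M_{σ · λ}` -/

/-- The submodule of the Verma module of highest weight `σ · λ` generated by the vectors
`fˇ_{σ(α)} v_{σ · λ}`, for all simple roots `α` of `l`. -/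
def singSub (q : ℂˣ) (c : Composition (r + 1)) (σ : Equiv.Perm (Fin (r + 1))) (lam : Weight r) :
    Submodule (Uq r q) (Verma q (dot q σ lam)) :=
  Submodule.span (Uq r q) {x | ∃ a ∈ leviRoots c,
    x = dynRoot q (σ a.castSucc) (σ a.succ) • vermaVec q (dot q σ lam)}

/-- The module `M_{σ · λ}`. -/
abbrev Msigma (q : ℂˣ) (c : Composition (r + 1)) (σ : Equiv.Perm (Fin (r + 1))) (lam : Weight r) :
    Type :=
  Verma q (dot q σ lam) ⧸ singSub q c σ lam

/-- `id ⊗ ϖ`, with `ϖ` the projection of the Verma module onto `M_{σ · λ}`. -/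
def idProj (q : ℂˣ) (c : Composition (r + 1)) (σ : Equiv.Perm (Fin (r + 1))) (lam : Weight r) :
    (Fin (r + 1) → ℂ) ⊗[ℂ] Verma q (dot q σ lam) →ₗ[ℂ]
      (Fin (r + 1) → ℂ) ⊗[ℂ] Msigma q c σ lam :=
  LinearMap.lTensor _ ((singSub q c σ lam).mkQ.restrictScalars ℂ)

/-- `V_i^{σ · λ}`, the image under `id ⊗ ϖ` of the term of the filtration with number `m_i^σ`
(which is `mSigma c σ i + 1`, as `mSigma` counts from `0`). -/
def V (q : ℂˣ) (c : Composition (r + 1)) (σ : Equiv.Perm (Fin (r + 1))) (lam : Weight r)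
    (i : Fin c.length) : Submodule ℂ ((Fin (r + 1) → ℂ) ⊗[ℂ] Msigma q c σ lam) :=
  (Vhat q (dot q σ lam) ((mSigma c σ i : ℕ) + 1)).map (idProj q c σ lam)

end QuantumGL
end

/-! Write `v` for the highest weight vector of `M_{σ·λ}` and `F_j` (`filt`) for the `U_q(n_-)`-span
of the `w_i ⊗ v` with 0-based index `i < j`. Since `id ⊗ ϖ` carries `Vhat` onto `F`
(`Vhat_map_idProj`), the argument takes place inside `ℂ^n ⊗ M_{σ·λ}` and uses only that `v` is a
highest weight generator (`IsHighest`). Each `F_j` is a `U_q(g)`-submodule because `e_α` sends `w_i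
⊗ v` to `w_{i-1} ⊗ v` or to zero (`IsHighest.filt_stable`), and the last one is everything
(`IsHighest.filt_top`).

The heart is `IsHighest.single_tmul_dynRoot`: modulo `F_m`, the vector `w_l ⊗ fˇ v` attached to `ε_l
- ε_m` is a non-zero multiple of `w_m ⊗ v`. From `Δ(f) = 1 ⊗ f + f ⊗ q^{-h}`, moving `f_{α_l}` off
the second factor replaces `w_l` by `w_{l+1}`, which drives an induction on `m - l`. Of the two
summands in the recursion for `fˇ`, the one with `f_{α_l}` on the right lies in `F_m`. The other
contributes the value of `[h_β + (ρ,β)]_q` as a factor, and this is non-zero exactly by regularity.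
A position `m` outside `σ(I_l)` is the right end of some `σ(α)`, `α` a simple root of `l`. There `fˇ
v = 0` in `M_{σ·λ}`, so `w_m ⊗ v ∈ F_m` and `F_{m+1} = F_m`. No position beyond `m_k^σ` lies in
`σ(I_l)`, so the filtration has already reached the whole space there.

For independence of `λ`: when every `σ(α)` is simple, the defining relations of `M_{σ·λ}` are `f_b v
= 0`, and each `f_b v` is singular, so the submodule they generate is already their `U_q(n_-)`-span
(`singSub_le_nSpan`). To send `v` to `v'` compatibly with all `f_α`, a map out of the Verma module
is needed. It is obtained by letting `U_q` act on the algebra `UMinus` presented by the `f_α` and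
the Serre relations (`vermaRep`, `exists_linearMap_verma`). The resulting isomorphism commutes with
`q^{-h_α}` only up to a scalar, and rescaling the `w_i` absorbs that scalar
(`IsHighest.tensorEquiv_f`). -/

noncomputable section

namespace QuantumGL

variable {r : ℕ} {q : ℂˣ}

/-! ### Stable subspaces of representations -/

section Stable

variable {X : Type*} [AddCommGroup X] [Module ℂ X]

lemma mem_of_mem_adjoin {U : Type*} [Ring U] [Algebra ℂ U] (R : U →ₐ[ℂ] Module.End ℂ X)
    {s : Set U} {P : Submodule ℂ X} (h : ∀ u ∈ s, ∀ x ∈ P, R u x ∈ P) {u : U}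
    (hu : u ∈ Algebra.adjoin ℂ s) : ∀ x ∈ P, R u x ∈ P := by
  induction hu using Algebra.adjoin_induction with
  | mem u hu => exact h u hu
  | algebraMap c =>
    intro x hx
    simpa [Module.algebraMap_end_apply] using P.smul_mem c hx
  | add u v _ _ hu hv =>
    intro x hx
    simpa using P.add_mem (hu x hx) (hv x hx)
  | mul u v _ _ hu hv =>
    intro x hx
    simpa using hu _ (hv x hx)

lemma adjoin_range_gen : Algebra.adjoin ℂ (Set.range (gen q : Gen r → Uq r q)) = ⊤ := by
  have h : Set.range (gen q : Gen r → Uq r q) = proj r q '' Set.range (FreeAlgebra.ι ℂ) := by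
    rw [← Set.range_comp]; rfl
  rw [h, ← AlgHom.map_adjoin, FreeAlgebra.adjoin_range_ι, Algebra.map_top, AlgHom.range_eq_top]
  exact RingQuot.mkAlgHom_surjective ℂ (Rel r q)

lemma mem_of_gen (R : Uq r q →ₐ[ℂ] Module.End ℂ X) {P : Submodule ℂ X}
    (hK : ∀ i, ∀ x ∈ P, R (K q i) x ∈ P) (hKinv : ∀ i, ∀ x ∈ P, R (Kinv q i) x ∈ P)
    (he : ∀ a, ∀ x ∈ P, R (e q a) x ∈ P) (hf : ∀ a, ∀ x ∈ P, R (f q a) x ∈ P)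
    (u : Uq r q) : ∀ x ∈ P, R u x ∈ P := by
  refine mem_of_mem_adjoin R (s := Set.range (gen q)) ?_ (by rw [adjoin_range_gen]; trivial)
  rintro _ ⟨g, rfl⟩
  cases g with
  | K i => exact hK i
  | Kinv i => exact hKinv i
  | e a => exact he a
  | f a => exact hf a

/-- The `U_q(n_-)`-submodule generated by a set of vectors, as a subspace. -/
def nSpan (R : Uq r q →ₐ[ℂ] Module.End ℂ X) (W : Set X) : Submodule ℂ X :=
  Submodule.span ℂ {x | ∃ y ∈ nMinus r q, ∃ w ∈ W, x = R y w}

variable {R : Uq r q →ₐ[ℂ] Module.End ℂ X} {W : Set X}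

lemma subset_nSpan {w : X} (hw : w ∈ W) : w ∈ nSpan R W :=
  Submodule.subset_span ⟨1, one_mem _, w, hw, by simp⟩

lemma f_mem_nMinus (a : Fin r) : f q a ∈ nMinus r q := Algebra.subset_adjoin ⟨a, rfl⟩

lemma nMinus_nSpan {y : Uq r q} (hy : y ∈ nMinus r q) {x : X} (hx : x ∈ nSpan R W) :
    R y x ∈ nSpan R W := by
  induction hx using Submodule.span_induction with
  | mem x h =>
    obtain ⟨z, hz, w, hw, rfl⟩ := h
    exact Submodule.subset_span ⟨y * z, mul_mem hy hz, w, hw, by simp⟩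
  | zero => simp
  | add x z _ _ hx hz => simpa using add_mem hx hz
  | smul c x _ hx => simpa using Submodule.smul_mem _ c hx

lemma f_nSpan (a : Fin r) {x : X} (hx : x ∈ nSpan R W) : R (f q a) x ∈ nSpan R W :=
  nMinus_nSpan (f_mem_nMinus a) hx

lemma nSpan_le {P : Submodule ℂ X} (hW : ∀ w ∈ W, w ∈ P)
    (hf : ∀ a, ∀ x ∈ P, R (f q a) x ∈ P) : nSpan R W ≤ P := by
  refine Submodule.span_le.2 ?_
  rintro _ ⟨y, hy, w, hw, rfl⟩
  refine mem_of_mem_adjoin R (s := Set.range (f q)) ?_ hy w (hW w hw)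
  rintro _ ⟨a, rfl⟩
  exact hf a

lemma nSpan_mono {W' : Set X} (h : W ⊆ W') : nSpan R W ≤ nSpan R W' :=
  nSpan_le (fun _ hw => subset_nSpan (h hw)) fun a _ hx => f_nSpan a hx

lemma nSpan_induction {T : Module.End ℂ X} (hW : ∀ w ∈ W, T w ∈ nSpan R W)
    (hf : ∀ a, ∀ x ∈ nSpan R W, T x ∈ nSpan R W → T (R (f q a) x) ∈ nSpan R W) :
    ∀ x ∈ nSpan R W, T x ∈ nSpan R W := by
  suffices h : nSpan R W ≤ nSpan R W ⊓ (nSpan R W).comap T from fun x hx => (h hx).2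
  exact nSpan_le (fun w hw => ⟨subset_nSpan hw, hW w hw⟩)
    fun a x hx => ⟨f_nSpan a hx.1, hf a x hx.1 hx.2⟩

/-- Only the generating vectors need checking: `K` and `K⁻¹` commute with each `f` up to a scalar,
and `e` commutes with `f` up to an element of the Cartan part. -/
lemma nSpan_stable (hq : (q : ℂ) - (q : ℂ)⁻¹ ≠ 0)
    (hK : ∀ i, ∀ w ∈ W, R (K q i) w ∈ nSpan R W)
    (hKinv : ∀ i, ∀ w ∈ W, R (Kinv q i) w ∈ nSpan R W)
    (he : ∀ a, ∀ w ∈ W, R (e q a) w ∈ nSpan R W) (u : Uq r q) :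
    ∀ x ∈ nSpan R W, R u x ∈ nSpan R W := by
  have hK' (i) : ∀ x ∈ nSpan R W, R (K q i) x ∈ nSpan R W := by
    refine nSpan_induction (hK i) fun a x _ hx => ?_
    rw [← Module.End.mul_apply, ← map_mul, K_mul_f, map_smul, map_mul]
    exact Submodule.smul_mem _ _ (f_nSpan a hx)
  have hKinv' (i) : ∀ x ∈ nSpan R W, R (Kinv q i) x ∈ nSpan R W := by
    refine nSpan_induction (hKinv i) fun a x _ hx => ?_
    rw [← Module.End.mul_apply, ← map_mul, Kinv_mul_f, map_smul, map_mul]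
    exact Submodule.smul_mem _ _ (f_nSpan a hx)
  refine mem_of_gen R hK' hKinv' (fun b => ?_) (fun a x => f_nSpan a) u
  refine nSpan_induction (he b) fun a x hx hex => ?_
  rw [← Module.End.mul_apply, ← map_mul]
  by_cases hab : b = a
  · subst hab
    have h := e_f_self (q := q) b
    rw [← eq_inv_smul_iff₀ hq, sub_eq_iff_eq_add] at h
    rw [h]
    simp only [k, kinv, map_add, map_smul, map_sub, map_mul, LinearMap.add_apply,
      LinearMap.smul_apply, LinearMap.sub_apply, Module.End.mul_apply]
    exact add_mem (Submodule.smul_mem _ _ (sub_mem (hK' _ _ (hKinv' _ _ hx))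
      (hKinv' _ _ (hK' _ _ hx)))) (f_nSpan _ hex)
  · rw [e_f_ne hab, map_mul]
    exact f_nSpan _ hex

end Stable

/-! ### Tensor products with the natural module -/

section Natural

lemma natRep_gen (g : Gen r) (w : Fin (r + 1) → ℂ) :
    natRep r q (gen q g) w = (natGen q g).mulVec w := by
  simp [natRep, lift_gen]

lemma natRep_f_castSucc (a : Fin r) :
    natRep r q (f q a) (Pi.single a.castSucc 1) = Pi.single a.succ 1 := by
  rw [natRep_gen]
  ext j
  simp [natGen, Matrix.single_apply, Pi.single_apply, eq_comm]

lemma natRep_f_of_ne {a : Fin r} {i : Fin (r + 1)} (h : a.castSucc ≠ i) :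
    natRep r q (f q a) (Pi.single i 1) = 0 := by
  rw [natRep_gen]
  ext j
  simp [natGen, h]

lemma natRep_e_succ (a : Fin r) :
    natRep r q (e q a) (Pi.single a.succ 1) = Pi.single a.castSucc 1 := by
  rw [natRep_gen]
  ext j
  simp [natGen, Matrix.single_apply, Pi.single_apply, eq_comm]

lemma natRep_e_of_ne {a : Fin r} {i : Fin (r + 1)} (h : a.succ ≠ i) :
    natRep r q (e q a) (Pi.single i 1) = 0 := by
  rw [natRep_gen]
  ext j
  simp [natGen, h]

lemma natRep_K (i j : Fin (r + 1)) :
    natRep r q (K q i) (Pi.single j 1) = (if j = i then (q : ℂ) else 1) • Pi.single j 1 := by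
  rw [natRep_gen]
  ext l
  by_cases h : l = j
  · subst h; simp [natGen]
  · simp [natGen, h]

lemma natRep_Kinv (i j : Fin (r + 1)) :
    natRep r q (Kinv q i) (Pi.single j 1) = (if j = i then (q : ℂ)⁻¹ else 1) • Pi.single j 1 := by
  rw [natRep_gen]
  ext l
  by_cases h : l = j
  · subst h; simp [natGen]
  · simp [natGen, h]

variable {M : Type} [AddCommGroup M] [Module ℂ M] [Module (Uq r q) M] [IsScalarTower ℂ (Uq r q) M]

lemma tensorRep_f (a : Fin r) (w : Fin (r + 1) → ℂ) (x : M) :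
    tensorRep r q M (f q a) (w ⊗ₜ x) =
      w ⊗ₜ (f q a • x) + natRep r q (f q a) w ⊗ₜ (kinv q a • x) := by
  simp [tensorRep, comul, lift_gen, comulGen, Module.endTensorEndAlgHom_apply]

lemma tensorRep_e (a : Fin r) (w : Fin (r + 1) → ℂ) (x : M) :
    tensorRep r q M (e q a) (w ⊗ₜ x) =
      natRep r q (e q a) w ⊗ₜ x + natRep r q (k q a) w ⊗ₜ (e q a • x) := by
  simp [tensorRep, comul, lift_gen, comulGen, Module.endTensorEndAlgHom_apply]

lemma tensorRep_K (i : Fin (r + 1)) (w : Fin (r + 1) → ℂ) (x : M) :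
    tensorRep r q M (K q i) (w ⊗ₜ x) = natRep r q (K q i) w ⊗ₜ (K q i • x) := by
  simp [tensorRep, comul, lift_gen, comulGen, Module.endTensorEndAlgHom_apply]

lemma tensorRep_Kinv (i : Fin (r + 1)) (w : Fin (r + 1) → ℂ) (x : M) :
    tensorRep r q M (Kinv q i) (w ⊗ₜ x) = natRep r q (Kinv q i) w ⊗ₜ (Kinv q i • x) := by
  simp [tensorRep, comul, lift_gen, comulGen, Module.endTensorEndAlgHom_apply]

end Natural

/-! ### Dynamical root vectors: recursion -/

lemma dynRoot_castSucc_succ (a : Fin r) : dynRoot q a.castSucc a.succ = f q a := by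
  rw [dynRoot, dif_pos a.castSucc_lt_succ]
  exact if_pos rfl

lemma dynRoot_castSucc (a : Fin r) {j : Fin (r + 1)} (h : a.succ < j) :
    dynRoot q a.castSucc j =
      f q a * dynRoot q a.succ j * qBracket q a.succ j ((j : ℤ) - (a.succ : Fin (r + 1)))
        - dynRoot q a.succ j * f q a *
          qBracket q a.succ j ((j : ℤ) - (a.succ : Fin (r + 1)) - 1) := by
  rw [dynRoot, dif_pos (a.castSucc_lt_succ.trans h)]
  have h1 : (j : ℤ) - (a.castSucc : Fin (r + 1)) - 1 = (j : ℤ) - (a.succ : Fin (r + 1)) := by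
    simp only [Fin.val_castSucc, Fin.val_succ]; push_cast; ring
  have h2 : (⟨(a.castSucc : Fin (r + 1)), a.2⟩ : Fin r) = a := rfl
  simp only [h2, h1, if_neg h.ne]

/-! ### Highest weight vectors and their Cartan eigenvalues. -/

section Highest

variable {M : Type} [AddCommGroup M] [Module ℂ M] [Module (Uq r q) M] [IsScalarTower ℂ (Uq r q) M]

/-- `v` is a highest weight vector of weight `μ` that generates `M`. -/
structure IsHighest (q : ℂˣ) {M : Type} [AddCommGroup M] [Module ℂ M] [Module (Uq r q) M]
    (μ : Weight r) (v : M) : Prop where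
  e_smul (a : Fin r) : e q a • v = 0
  K_smul (i : Fin (r + 1)) : K q i • v = (μ i : ℂ) • v
  span_eq : Submodule.span (Uq r q) {v} = ⊤

variable {μ : Weight r} {v : M}

lemma uq_smul_comm (u : Uq r q) (c : ℂ) (x : M) : u • c • x = c • u • x := by
  rw [← algebraMap_smul (Uq r q) c x, ← algebraMap_smul (Uq r q) c (u • x), smul_smul, smul_smul,
    Algebra.commutes]

lemma IsHighest.Kinv_smul (h : IsHighest q μ v) (i : Fin (r + 1)) :
    Kinv q i • v = (μ i : ℂ)⁻¹ • v := by
  rw [eq_inv_smul_iff₀ (μ i).ne_zero, ← uq_smul_comm, ← h.K_smul, smul_smul, Kinv_mul_K, one_smul]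

lemma IsHighest.kinv_smul (h : IsHighest q μ v) (a : Fin r) :
    kinv q a • v = ((μ a.succ : ℂ) * (μ a.castSucc : ℂ)⁻¹) • v := by
  rw [kinv, mul_smul, h.K_smul, uq_smul_comm, h.Kinv_smul, smul_smul]

/-- The value of `[h_β + m]_q`, `β = ε_i - ε_j`, at the weight `μ`. -/
def bracketValue (q : ℂˣ) (μ : Weight r) (i j : Fin (r + 1)) (m : ℤ) : ℂ :=
  ((q : ℂ) - (q : ℂ)⁻¹)⁻¹ *
    ((q : ℂ) ^ m * ((μ j : ℂ)⁻¹ * μ i) - (q : ℂ) ^ (-m) * (μ j * (μ i : ℂ)⁻¹))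

lemma IsHighest.qBracket_smul (h : IsHighest q μ v) (i j : Fin (r + 1)) (m : ℤ) :
    qBracket q i j m • v = bracketValue q μ i j m • v := by
  simp only [qBracket, smul_assoc, sub_smul, mul_smul, h.K_smul, h.Kinv_smul, uq_smul_comm,
    bracketValue]

/-- The bracket vanishes only if `q^{j-i} μ_i / μ_j` equals its own inverse, that is, if `μ_i²
q^{-2i} = μ_j² q^{-2j}`. The shift `j - i` is `(ρ, ε_i - ε_j)`. -/
lemma bracketValue_ne_zero (hq : (q : ℂ) - (q : ℂ)⁻¹ ≠ 0) {i j : Fin (r + 1)}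
    (h : xhat q μ i ≠ xhat q μ j) : bracketValue q μ i j ((j : ℤ) - i) ≠ 0 := by
  refine mul_ne_zero (inv_ne_zero hq) fun h0 => h ?_
  have hi := (μ i).ne_zero
  have hj := (μ j).ne_zero
  have hq0 := q.ne_zero
  rw [sub_eq_zero, zpow_neg, zpow_sub₀ hq0] at h0
  simp only [zpow_natCast] at h0
  field_simp at h0
  ext
  simp only [xhat, Units.val_mul, Units.val_pow_eq_pow_val, Units.val_zpow_eq_zpow_val]
  have e1 (n : ℕ) : (q : ℂ) ^ (-2 * (n : ℤ)) = (((q : ℂ) ^ n) ^ 2)⁻¹ := by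
    rw [neg_mul, zpow_neg, ← pow_mul, mul_comm n 2]; norm_cast
  rw [e1, e1]
  field_simp
  linear_combination h0

/-! ### The filtration of `ℂ^n ⊗ M` -/

variable (r q) in
/-- The `U_q(n_-)`-submodule of `ℂ^n ⊗ M` generated by `w_i ⊗ v` for the first `j` basis
vectors `w_i`. -/
def filt (v : M) (j : ℕ) : Submodule ℂ ((Fin (r + 1) → ℂ) ⊗[ℂ] M) :=
  nSpan (tensorRep r q M) {x | ∃ i : Fin (r + 1), (i : ℕ) < j ∧ x = Pi.single i 1 ⊗ₜ v}

lemma single_mem_filt {i : Fin (r + 1)} {j : ℕ} (h : (i : ℕ) < j) :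
    (Pi.single i 1 : Fin (r + 1) → ℂ) ⊗ₜ v ∈ filt r q v j :=
  subset_nSpan ⟨i, h, rfl⟩

lemma filt_mono {i j : ℕ} (h : i ≤ j) : filt r q v i ≤ filt r q v j :=
  nSpan_mono fun _ ⟨l, hl, hx⟩ => ⟨l, hl.trans_le h, hx⟩

/-- The raising operators kill `v`, so on `w_l ⊗ v` they act through the first factor and can only
lower the index `l`. -/
lemma IsHighest.filt_stable (h : IsHighest q μ v) (hq : (q : ℂ) - (q : ℂ)⁻¹ ≠ 0) (j : ℕ)
    (u : Uq r q) : ∀ x ∈ filt r q v j, tensorRep r q M u x ∈ filt r q v j := by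
  refine nSpan_stable hq ?_ ?_ ?_ u
  · rintro i _ ⟨l, hl, rfl⟩
    rw [tensorRep_K, natRep_K,  h.K_smul, TensorProduct.tmul_smul, ← TensorProduct.smul_tmul']
    exact Submodule.smul_mem _ _ (Submodule.smul_mem _ _ (single_mem_filt hl))
  · rintro i _ ⟨l, hl, rfl⟩
    rw [tensorRep_Kinv, natRep_Kinv, h.Kinv_smul, TensorProduct.tmul_smul,
      ← TensorProduct.smul_tmul']
    exact Submodule.smul_mem _ _ (Submodule.smul_mem _ _ (single_mem_filt hl))
  · rintro a _ ⟨l, hl, rfl⟩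
    rw [tensorRep_e, h.e_smul, TensorProduct.tmul_zero, add_zero]
    by_cases hal : a.succ = l
    · subst hal
      rw [natRep_e_succ]
      exact single_mem_filt (lt_of_le_of_lt (by simp) hl)
    · rw [natRep_e_of_ne hal, TensorProduct.zero_tmul]
      exact zero_mem _

lemma natRep_K_mul (i : Fin (r + 1)) (w : Fin (r + 1) → ℂ) :
    natRep r q (K q i) (natRep r q (Kinv q i) w) = w := by
  rw [← Module.End.mul_apply, ← map_mul, K_mul_Kinv]; simp

lemma natRep_Kinv_mul (i : Fin (r + 1)) (w : Fin (r + 1) → ℂ) :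
    natRep r q (Kinv q i) (natRep r q (K q i) w) = w := by
  rw [← Module.End.mul_apply, ← map_mul, Kinv_mul_K]; simp

lemma IsHighest.filt_top (h : IsHighest q μ v) (hq : (q : ℂ) - (q : ℂ)⁻¹ ≠ 0) :
    filt r q v (r + 1) = ⊤ := by
  have hs := h.filt_stable hq (r + 1)
  -- `P` consists of the `x` with `w ⊗ x` in the filtration for every `w`. Quantifying over all `w`
  -- makes `P` stable under `U_q`, because the Cartan factors that the comultiplication puts on `w`
  -- are invertible. It contains the generator `v`, hence is all of `M`.
  let P : Submodule ℂ M := ⨅ w : Fin (r + 1) → ℂ, (filt r q v (r + 1)).comap (TensorProduct.mk ℂ _ _ w)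
  have hP {x : M} : x ∈ P ↔ ∀ w : Fin (r + 1) → ℂ, w ⊗ₜ x ∈ filt r q v (r + 1) := by
    simp [P, Submodule.mem_iInf]
  have hK (i : Fin (r + 1)) : ∀ x ∈ P, K q i • x ∈ P := by
    intro x hx
    rw [hP] at hx ⊢
    intro w
    have := hs (K q i) _ (hx (natRep r q (Kinv q i) w))
    rwa [tensorRep_K, natRep_K_mul] at this
  have hKinv (i : Fin (r + 1)) : ∀ x ∈ P, Kinv q i • x ∈ P := by
    intro x hx
    rw [hP] at hx ⊢
    intro w
    have := hs (Kinv q i) _ (hx (natRep r q (K q i) w))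
    rwa [tensorRep_Kinv, natRep_Kinv_mul] at this
  have hU (u : Uq r q) : ∀ x ∈ P, u • x ∈ P := by
    refine mem_of_gen (Algebra.lsmul ℂ ℂ M) (P := P) hK hKinv ?_ ?_ u
    · intro a x hx
      rw [hP] at hx ⊢
      intro w
      -- The first factor is `q^{-h_α} w`, so that the summand `q^{h_α} ⊗ e_α` of `Δ(e_α)` yields
      -- exactly `w ⊗ e_α x`. The other summand stays over `x` and is subtracted.
      have h1 := hs (e q a) _ (hx (natRep r q (K q a.succ) (natRep r q (Kinv q a.castSucc) w)))
      rw [tensorRep_e, k, map_mul, Module.End.mul_apply, natRep_Kinv_mul, natRep_K_mul] at h1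
      have h2 := sub_mem h1 (hx (natRep r q (e q a)
        (natRep r q (K q a.succ) (natRep r q (Kinv q a.castSucc) w))))
      rwa [add_sub_cancel_left] at h2
    · intro a x hx
      have h2 : kinv q a • x ∈ P := by
        rw [kinv, mul_smul]; exact hKinv _ _ (hK _ _ hx)
      rw [hP] at hx h2 ⊢
      intro w
      have h1 := hs (f q a) _ (hx w)
      rw [tensorRep_f] at h1
      simpa using sub_mem h1 (h2 (natRep r q (f q a) w))
  have hv : v ∈ P := by
    rw [hP]
    intro w
    rw [pi_eq_sum_univ w, TensorProduct.sum_tmul]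
    refine sum_mem fun i _ => ?_
    rw [← TensorProduct.smul_tmul']
    refine Submodule.smul_mem _ _ ?_
    convert single_mem_filt (r := r) (q := q) (v := v) i.2 using 2
    ext j; simp [Pi.single_apply, eq_comm]
  have hall (x : M) : x ∈ P := by
    have hx : x ∈ Submodule.span (Uq r q) {v} := by rw [h.span_eq]; trivial
    obtain ⟨u, rfl⟩ := Submodule.mem_span_singleton.1 hx
    exact hU u v hv
  rw [eq_top_iff, ← TensorProduct.span_tmul_eq_top ℂ, Submodule.span_le]
  rintro _ ⟨w, x, rfl⟩
  exact hP.1 (hall x) w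

end Highest

section Highest

variable {M : Type} [AddCommGroup M] [Module ℂ M] [Module (Uq r q) M] [IsScalarTower ℂ (Uq r q) M]

/-! ### Dynamical root vectors in the tensor product -/

variable (q M) in
/-- The elements of `U_q` that act on `w_l ⊗ M` through the second factor. -/
def rightActing (l : Fin (r + 1)) : Subalgebra ℂ (Uq r q) where
  carrier := {y | ∀ x : M, tensorRep r q M y (Pi.single l 1 ⊗ₜ x) = Pi.single l 1 ⊗ₜ (y • x)}
  mul_mem' {y z} hy hz x := by
    rw [map_mul, Module.End.mul_apply, hz, hy, mul_smul]
  add_mem' {y z} hy hz x := by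
    rw [map_add, LinearMap.add_apply, hy, hz, add_smul, TensorProduct.tmul_add]
  algebraMap_mem' c x := by
    simp [Module.algebraMap_end_apply]

lemma K_mem_rightActing {i l : Fin (r + 1)} (h : l ≠ i) : K q i ∈ rightActing q M l := by
  intro x
  rw [tensorRep_K, natRep_K, if_neg h, one_smul]

lemma Kinv_mem_rightActing {i l : Fin (r + 1)} (h : l ≠ i) : Kinv q i ∈ rightActing q M l := by
  intro x
  rw [tensorRep_Kinv, natRep_Kinv, if_neg h, one_smul]

lemma f_mem_rightActing {a : Fin r} {l : Fin (r + 1)} (h : a.castSucc ≠ l) :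
    f q a ∈ rightActing q M l := by
  intro x
  rw [tensorRep_f, natRep_f_of_ne h, TensorProduct.zero_tmul, add_zero]

lemma qBracket_mem_rightActing {i j l : Fin (r + 1)} (hi : l ≠ i) (hj : l ≠ j) (m : ℤ) :
    qBracket q i j m ∈ rightActing q M l :=
  Subalgebra.smul_mem _ (sub_mem
    (Subalgebra.smul_mem _ (mul_mem (K_mem_rightActing hi) (Kinv_mem_rightActing hj)) _)
    (Subalgebra.smul_mem _ (mul_mem (Kinv_mem_rightActing hi) (K_mem_rightActing hj)) _)) _

/-- The root vector of `ε_i - ε_j` involves only `f_{α_b}` with `b ≥ i` and Cartan elements at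
positions beyond `i`. The former kill `w_l` and the latter fix it when `l < i`. -/
lemma dynRoot_mem_rightActing {i j l : Fin (r + 1)} (h : l < i) :
    dynRoot q i j ∈ rightActing q M l := by
  by_cases hij : i < j
  · obtain ⟨n, hn⟩ : ∃ n, n = (j : ℕ) - i := ⟨_, rfl⟩
    induction n using Nat.strong_induction_on generalizing i with
    | _ n ih =>
      obtain ⟨a, rfl⟩ : ∃ a : Fin r, a.castSucc = i := Fin.exists_castSucc_eq.2 (by
        rintro rfl; exact absurd (Fin.le_last j) (not_le.2 hij))
      have hf : f q a ∈ rightActing q M l := f_mem_rightActing h.ne'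
      rcases (Fin.castSucc_lt_iff_succ_le.1 hij).eq_or_lt with rfl | hj
      · rwa [dynRoot_castSucc_succ]
      · have hla := h.trans a.castSucc_lt_succ
        have hd := ih _ (by simp only [Fin.val_succ, Fin.val_castSucc, Fin.lt_def] at *; omega)
          hla hj rfl
        have hb := qBracket_mem_rightActing (q := q) (M := M) hla.ne (hla.trans hj).ne
        rw [dynRoot_castSucc a hj]
        exact sub_mem (mul_mem (mul_mem hf hd) (hb _)) (mul_mem (mul_mem hd hf) (hb _))
  · rw [dynRoot, dif_neg hij]
    exact zero_mem _

variable {μ : Weight r} {v : M}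

lemma single_tmul_f_smul (a : Fin r) (x : M) :
    (Pi.single a.castSucc 1 : Fin (r + 1) → ℂ) ⊗ₜ[ℂ] (f q a • x) =
      tensorRep r q M (f q a) (Pi.single a.castSucc 1 ⊗ₜ x) -
        Pi.single a.succ 1 ⊗ₜ (kinv q a • x) := by
  rw [tensorRep_f, natRep_f_castSucc, add_sub_cancel_right]

lemma tensorRep_kinv_succ (a : Fin r) (x : M) :
    tensorRep r q M (kinv q a) (Pi.single a.succ 1 ⊗ₜ x) =
      (q : ℂ) • (Pi.single a.succ 1 ⊗ₜ (kinv q a • x)) := by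
  rw [kinv, map_mul, Module.End.mul_apply, tensorRep_K, natRep_K, if_pos rfl,
    ← TensorProduct.smul_tmul', map_smul, tensorRep_Kinv, natRep_Kinv,
    if_neg a.castSucc_lt_succ.ne', one_smul, mul_smul]

lemma IsHighest.tensorRep_kinv (h : IsHighest q μ v) (a : Fin r) (i : Fin (r + 1)) :
    ∃ c : ℂ, c ≠ 0 ∧ tensorRep r q M (kinv q a) (Pi.single i 1 ⊗ₜ v) =
      c • (Pi.single i 1 ⊗ₜ v) := by
  rw [kinv, map_mul, Module.End.mul_apply, tensorRep_K, natRep_K, h.K_smul,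
    TensorProduct.tmul_smul, ← TensorProduct.smul_tmul', map_smul, map_smul, tensorRep_Kinv,
    natRep_Kinv, h.Kinv_smul, TensorProduct.tmul_smul, ← TensorProduct.smul_tmul', smul_smul,
    smul_smul, smul_smul]
  refine ⟨_, ?_, rfl⟩
  have := (μ a.succ).ne_zero
  have := (μ a.castSucc).ne_zero
  have := q.ne_zero
  split_ifs <;> simp_all

/-- Modulo the term number `m` of the filtration, `w_l ⊗ fˇ v` is a non-zero multiple of
`w_m ⊗ v`, where `fˇ` is the dynamical root vector attached to `ε_l - ε_m`. -/
lemma IsHighest.single_tmul_dynRoot (h : IsHighest q μ v) (hq : (q : ℂ) - (q : ℂ)⁻¹ ≠ 0)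
    {l m : Fin (r + 1)} (hlm : l < m) (hreg : ∀ j, l < j → j < m → xhat q μ j ≠ xhat q μ m) :
    ∃ c : ℂ, c ≠ 0 ∧ (Pi.single l 1 : Fin (r + 1) → ℂ) ⊗ₜ (dynRoot q l m • v) -
      c • (Pi.single m 1 ⊗ₜ v) ∈ filt r q v m := by
  have hs := h.filt_stable hq m
  obtain ⟨n, hn⟩ : ∃ n, n = (m : ℕ) - l := ⟨_, rfl⟩
  induction n using Nat.strong_induction_on generalizing l with
  | _ n ih =>
    obtain ⟨a, rfl⟩ : ∃ a : Fin r, a.castSucc = l := Fin.exists_castSucc_eq.2 (by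
      rintro rfl; exact absurd (Fin.le_last m) (not_le.2 hlm))
    have hl : (Pi.single a.castSucc 1 : Fin (r + 1) → ℂ) ⊗ₜ v ∈ filt r q v m := single_mem_filt hlm
    have hfl := hs (f q a) _ hl
    rcases (Fin.castSucc_lt_iff_succ_le.1 hlm).eq_or_lt with rfl | hm
    -- For a simple root, `f_α (w_l ⊗ v) = w_l ⊗ f_α v + w_{l+1} ⊗ q^{-h_α} v` lies in the
    -- filtration, and the constant is minus the eigenvalue of `q^{-h_α}` on `v`.
    · refine ⟨-((μ a.succ : ℂ) * (μ a.castSucc : ℂ)⁻¹), by simp, ?_⟩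
      convert hfl using 1
      rw [dynRoot_castSucc_succ, single_tmul_f_smul, h.kinv_smul, TensorProduct.tmul_smul]
      module
    · obtain ⟨c, hc, hmem⟩ := ih _
        (by simp only [Fin.val_succ, Fin.val_castSucc, Fin.lt_def] at *; omega) hm
        (fun j hj => hreg j (a.castSucc_lt_succ.trans hj)) rfl
      obtain ⟨d, hd, hdv⟩ := h.tensorRep_kinv a m
      set F := dynRoot q a.succ m
      set b := bracketValue q μ a.succ m ((m : ℤ) - (a.succ : Fin (r + 1)))
      -- Regularity enters here, for the pair `l + 1`, `m`. The other bracket of the recursion may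
      -- vanish, since its summand lies in the filtration anyway.
      have hb : b ≠ 0 := bracketValue_ne_zero hq (hreg _ a.castSucc_lt_succ hm)
      have hF (x : M) : tensorRep r q M F (Pi.single a.castSucc 1 ⊗ₜ x) =
          Pi.single a.castSucc 1 ⊗ₜ (F • x) :=
        dynRoot_mem_rightActing a.castSucc_lt_succ x
      -- the second summand of the dynamical root vector
      have h2 : (Pi.single a.castSucc 1 : Fin (r + 1) → ℂ) ⊗ₜ (F • f q a • v) ∈ filt r q v m := by
        rw [← hF, single_tmul_f_smul, h.kinv_smul, TensorProduct.tmul_smul]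
        exact hs _ _ (sub_mem hfl (Submodule.smul_mem _ _ (single_mem_filt hm)))
      -- The induction hypothesis is transported by the action of `q^{-h_α}` on the tensor product.
      -- That action carries an extra factor `q` from `w_{l+1}`, whence `q⁻¹`, and has eigenvalue
      -- `d` on `w_m ⊗ v`.
      have h1 : (Pi.single a.succ 1 : Fin (r + 1) → ℂ) ⊗ₜ (kinv q a • F • v) -
          ((q : ℂ)⁻¹ * (c * d)) • (Pi.single m 1 ⊗ₜ v) ∈ filt r q v m := by
        have := hs (kinv q a) _ hmem
        rw [map_sub, map_smul, hdv, tensorRep_kinv_succ] at this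
        have := Submodule.smul_mem _ ((q : ℂ)⁻¹) this
        rwa [smul_sub, inv_smul_smul₀ q.ne_zero, smul_smul c, smul_smul (q : ℂ)⁻¹] at this
      have h3 := hs (f q a) _ (hs F _ hl)
      rw [hF] at h3
      -- The sign comes from moving `f_α` off the second factor, and `b` is the value of the first
      -- bracket in the recursion.
      refine ⟨-(b * ((q : ℂ)⁻¹ * (c * d))), by simp [hb, hc, hd], ?_⟩
      rw [dynRoot_castSucc a hm]
      simp only [sub_smul, mul_smul, h.qBracket_smul, uq_smul_comm, TensorProduct.tmul_sub,
        TensorProduct.tmul_smul, single_tmul_f_smul]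
      have h4 := sub_mem (Submodule.smul_mem _ b (sub_mem h3 h1)) (Submodule.smul_mem _
        (bracketValue q μ a.succ m ((m : ℤ) - (a.succ : Fin (r + 1)) - 1)) h2)
      convert h4 using 1
      rw [← hF (f q a • v), ← hF, single_tmul_f_smul]
      module

/-- The only new generator is `w_m ⊗ v`. Once the dynamical root vector kills `v`, the congruence
for `w_l ⊗ fˇ v` puts a non-zero multiple of it in the earlier term. -/
lemma IsHighest.filt_succ_eq (h : IsHighest q μ v) (hq : (q : ℂ) - (q : ℂ)⁻¹ ≠ 0)
    {l m : Fin (r + 1)} (hlm : l < m) (hreg : ∀ j, l < j → j < m → xhat q μ j ≠ xhat q μ m)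
    (hv : dynRoot q l m • v = 0) : filt r q v (m + 1) = filt r q v m := by
  refine le_antisymm (nSpan_le ?_ fun a x hx => f_nSpan a hx) (filt_mono (Nat.le_succ _))
  rintro _ ⟨i, hi, rfl⟩
  rcases (Nat.lt_succ_iff.1 hi).eq_or_lt with him | him
  · obtain ⟨c, hc, hmem⟩ := h.single_tmul_dynRoot hq hlm hreg
    rw [hv, TensorProduct.tmul_zero, zero_sub, neg_mem_iff] at hmem
    rw [Fin.ext him]
    exact (Submodule.smul_mem_iff _ hc).1 hmem
  · exact single_mem_filt him

/-- Equalities of consecutive terms of the filtration add up. -/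
lemma filt_eq_of_forall {i j : ℕ} (hij : i ≤ j) (hj : j ≤ r + 1)
    (h : ∀ m : Fin (r + 1), i ≤ m → (m : ℕ) < j → filt r q v (m + 1) = filt r q v m) :
    filt r q v j = filt r q v i := by
  induction j, hij using Nat.le_induction with
  | base => rfl
  | succ j hij ih =>
    exact (h ⟨j, hj⟩ hij (Nat.lt_succ_self j)).trans
      (ih (by omega) fun m h1 h2 => h m h1 (h2.trans (Nat.lt_succ_self j)))

end Highest

/-! ### Functoriality of the filtration in the highest weight module. -/

section Functorial

variable {M N : Type} [AddCommGroup M] [Module ℂ M] [Module (Uq r q) M]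
  [IsScalarTower ℂ (Uq r q) M] [AddCommGroup N] [Module ℂ N] [Module (Uq r q) N]
  [IsScalarTower ℂ (Uq r q) N]

lemma tensorRep_lTensor (g : M →ₗ[Uq r q] N) (u : Uq r q) (x : (Fin (r + 1) → ℂ) ⊗[ℂ] M) :
    tensorRep r q N u (LinearMap.lTensor _ (g.restrictScalars ℂ) x) =
      LinearMap.lTensor _ (g.restrictScalars ℂ) (tensorRep r q M u x) := by
  simp only [tensorRep, AlgHom.comp_apply]
  induction comul r q u using TensorProduct.induction_on with
  | zero => simp
  | add y z hy hz => simp [hy, hz]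
  | tmul y z =>
    induction x using TensorProduct.induction_on with
    | zero => simp
    | add x x' hx hx' => simp only [map_add, hx, hx']
    | tmul w x => simp [Module.endTensorEndAlgHom_apply]

lemma filt_map (g : M →ₗ[Uq r q] N) (v : M) (j : ℕ) :
    (filt r q v j).map (LinearMap.lTensor _ (g.restrictScalars ℂ)) = filt r q (g v) j := by
  refine le_antisymm (Submodule.map_le_iff_le_comap.2 (nSpan_le ?_ ?_)) (nSpan_le ?_ ?_)
  · rintro _ ⟨i, hi, rfl⟩
    exact single_mem_filt hi
  · intro a x hx
    rw [Submodule.mem_comap, ← tensorRep_lTensor]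
    exact f_nSpan a hx
  · rintro _ ⟨i, hi, rfl⟩
    exact ⟨_, single_mem_filt hi, rfl⟩
  · rintro a _ ⟨x, hx, rfl⟩
    exact ⟨_, f_nSpan a hx, (tensorRep_lTensor g _ x).symm⟩

lemma IsHighest.map {μ : Weight r} {v : M} (h : IsHighest q μ v) {g : M →ₗ[Uq r q] N}
    (hg : Function.Surjective g) : IsHighest q μ (g v) where
  e_smul a := by rw [← map_smul, h.e_smul, map_zero]
  K_smul i := by
    rw [← map_smul, h.K_smul]
    exact (g.restrictScalars ℂ).map_smul _ _
  span_eq := by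
    rw [← Set.image_singleton, ← Submodule.map_span, h.span_eq, Submodule.map_top,
      LinearMap.range_eq_top.2 hg]

end Functorial

/-! ### Verma modules as highest weight modules. -/

lemma isHighest_vermaVec (μ : Weight r) : IsHighest q μ (vermaVec q μ) where
  e_smul a := by
    rw [vermaVec, ← map_smul, smul_eq_mul, mul_one, Submodule.mkQ_apply,
      Submodule.Quotient.mk_eq_zero]
    exact Submodule.subset_span (Or.inl ⟨a, rfl⟩)
  K_smul i := by
    have h : K q i - algebraMap ℂ (Uq r q) (μ i) ∈ vermaIdeal q μ :=
      Submodule.subset_span (Or.inr ⟨i, rfl⟩)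
    rw [← Submodule.Quotient.mk_eq_zero, Submodule.Quotient.mk_sub, sub_eq_zero] at h
    rw [vermaVec, ← map_smul, smul_eq_mul, mul_one]
    refine h.trans ?_
    rw [Algebra.algebraMap_eq_smul_one]
    rfl
  span_eq := by
    rw [vermaVec, ← Set.image_singleton, ← Submodule.map_span]
    change Submodule.map _ (Ideal.span {1}) = ⊤
    rw [Ideal.span_singleton_one, Submodule.map_top, Submodule.range_mkQ]

lemma Vhat_eq_filt (μ : Weight r) (j : ℕ) : Vhat q μ j = filt r q (vermaVec q μ) j := by
  refine congrArg (Submodule.span ℂ) (Set.ext fun x => ⟨?_, ?_⟩)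
  · rintro ⟨y, hy, i, hi, rfl⟩
    exact ⟨y, hy, _, ⟨i, hi, rfl⟩, rfl⟩
  · rintro ⟨y, hy, _, ⟨i, hi, rfl⟩, rfl⟩
    exact ⟨y, hy, i, hi, rfl⟩

/-! ### The module `M_{σ · λ}` -/

variable {c : Composition (r + 1)} {σ : Equiv.Perm (Fin (r + 1))} {lam : Weight r}

variable (q c σ lam) in
/-- The highest weight vector of `M_{σ · λ}`. -/
def mVec : Msigma q c σ lam := (singSub q c σ lam).mkQ (vermaVec q (dot q σ lam))

lemma isHighest_mVec : IsHighest q (dot q σ lam) (mVec q c σ lam) :=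
  (isHighest_vermaVec _).map (Submodule.mkQ_surjective _)

lemma Vhat_map_idProj (j : ℕ) :
    (Vhat q (dot q σ lam) j).map (idProj q c σ lam) = filt r q (mVec q c σ lam) j := by
  rw [Vhat_eq_filt]
  exact filt_map _ _ _

lemma V_eq_filt (i : Fin c.length) :
    V q c σ lam i = filt r q (mVec q c σ lam) ((mSigma c σ i : ℕ) + 1) :=
  Vhat_map_idProj _

lemma dynRoot_smul_mVec {a : Fin r} (ha : a ∈ leviRoots c) :
    dynRoot q (σ a.castSucc) (σ a.succ) • mVec q c σ lam = 0 := by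
  rw [mVec, ← map_smul, Submodule.mkQ_apply, Submodule.Quotient.mk_eq_zero]
  exact Submodule.subset_span ⟨a, ha, rfl⟩

lemma exists_leviRoot_of_notMem {m : Fin (r + 1)} (hm : m ∉ leadSet c σ) :
    ∃ a ∈ leviRoots c, σ a.succ = m := by
  obtain ⟨b, rfl⟩ := σ.surjective m
  -- `b` is not the first position of its block, so its predecessor lies in the same block and the
  -- two span a simple root of `l`.
  have hb : (c.invEmbedding b : ℕ) ≠ 0 := by
    intro h0
    refine hm (Finset.mem_image.2 ⟨c.index b, Finset.mem_univ _, congrArg σ ?_⟩)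
    exact (congrArg (c.embedding (c.index b)) (Fin.ext h0.symm)).trans (c.embedding_comp_inv b)
  have hbv : (b : ℕ) = c.sizeUpTo (c.index b) + c.invEmbedding b := by
    rw [← Composition.coe_embedding, c.embedding_comp_inv b]
  obtain ⟨a, rfl⟩ : ∃ a : Fin r, a.succ = b := Fin.exists_succ_eq.2 (by
    rintro rfl
    rw [Fin.val_zero] at hbv
    omega)
  refine ⟨a, ?_, rfl⟩
  have hlt := (c.invEmbedding a.succ).2
  have : a.castSucc = c.embedding (c.index a.succ) ⟨c.invEmbedding a.succ - 1, by omega⟩ := by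
    ext
    rw [Composition.coe_embedding]
    simp only [Fin.val_succ, Fin.val_castSucc] at *
    omega
  rw [leviRoots, Set.mem_ofPred_eq, this, Composition.index_embedding]

lemma filt_mVec_succ_eq (hq : (q : ℂ) - (q : ℂ)⁻¹ ≠ 0) (hσ : Admissible c σ)
    (hreg : Regular q c σ lam) {m : Fin (r + 1)} (hm : m ∉ leadSet c σ) :
    filt r q (mVec q c σ lam) (m + 1) = filt r q (mVec q c σ lam) m := by
  obtain ⟨a, ha, rfl⟩ := exists_leviRoot_of_notMem hm
  exact isHighest_mVec.filt_succ_eq hq (hσ _ _ ha a.castSucc_lt_succ) (hreg a ha)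
    (dynRoot_smul_mVec ha)

lemma V_last_eq_top (hq : (q : ℂ) - (q : ℂ)⁻¹ ≠ 0) (hσ : Admissible c σ)
    (hreg : Regular q c σ lam) {i : Fin c.length} (hi : (i : ℕ) + 1 = c.length) :
    V q c σ lam i = ⊤ := by
  rw [V_eq_filt, ← isHighest_mVec.filt_top hq]
  -- `i` is the last index, so every position after `mSigma c σ i` is outside `leadSet` and
  -- contributes nothing new.
  refine (filt_eq_of_forall (mSigma c σ i).2 le_rfl fun m hm _ =>
    filt_mVec_succ_eq hq hσ hreg fun hmem => ?_).symm
  obtain ⟨j, rfl⟩ : m ∈ Set.range ((leadSet c σ).orderEmbOfFin (card_leadSet c σ)) := by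
    rw [Finset.range_orderEmbOfFin]
    exact hmem
  have : (mSigma c σ) j ≤ (mSigma c σ) i := (mSigma c σ).monotone (by
    rw [Fin.le_def]; omega)
  exact absurd (Nat.lt_of_succ_le hm) (not_lt.2 this)

/-! ### The algebra presented by the `f_α` and the Serre relations -/

open FreeAlgebra in
/-- The Serre relations between the `f_α`. -/
inductive RelMinus (r : ℕ) (q : ℂˣ) : FreeAlgebra ℂ (Fin r) → FreeAlgebra ℂ (Fin r) → Prop
  | serre (a b) (h : Neighbours a b) : RelMinus r q (serre q (ι ℂ a) (ι ℂ b)) 0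
  | comm (a b : Fin r) (h : (a : ℕ) + 1 < b) : RelMinus r q (ι ℂ a * ι ℂ b) (ι ℂ b * ι ℂ a)

/-- The algebra generated by the `f_α` subject to the Serre relations. -/
def UMinus (r : ℕ) (q : ℂˣ) : Type := RingQuot (RelMinus r q)

instance (r : ℕ) (q : ℂˣ) : Ring (UMinus r q) := inferInstanceAs (Ring (RingQuot (RelMinus r q)))
instance (r : ℕ) (q : ℂˣ) : Algebra ℂ (UMinus r q) :=
  inferInstanceAs (Algebra ℂ (RingQuot (RelMinus r q)))

lemma map_serre {A B : Type*} [Ring A] [Algebra ℂ A] [Ring B] [Algebra ℂ B] (φ : A →ₐ[ℂ] B)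
    (x y : A) : φ (serre q x y) = serre q (φ x) (φ y) := by
  simp [serre]

lemma serre_smul_smul {A : Type*} [Ring A] [Algebra ℂ A] (s t : ℂ) (x y : A) :
    serre q (s • x) (t • y) = (s * s * t) • serre q x y := by
  simp only [serre, smul_mul_smul_comm]
  module

namespace UMinus

/-- The quotient map from the free algebra. -/
def proj (r : ℕ) (q : ℂˣ) : FreeAlgebra ℂ (Fin r) →ₐ[ℂ] UMinus r q :=
  RingQuot.mkAlgHom ℂ (RelMinus r q)

/-- The generator `f_{α_a}`. -/
def f (q : ℂˣ) (a : Fin r) : UMinus r q := proj r q (FreeAlgebra.ι ℂ a)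

lemma serre_f {a b : Fin r} (h : Neighbours a b) : serre q (f q a) (f q b) = 0 := by
  rw [f, f, ← map_serre, ← map_zero (proj r q)]
  exact RingQuot.mkAlgHom_rel ℂ (RelMinus.serre a b h)

lemma f_mul_f {a b : Fin r} (h : (a : ℕ) + 1 < b) : f q a * f q b = f q b * f q a := by
  rw [f, f, ← map_mul, ← map_mul]
  exact RingQuot.mkAlgHom_rel ℂ (RelMinus.comm a b h)

section Lift

variable {A : Type*} [Ring A] [Algebra ℂ A] (φ : Fin r → A)
  (hs : ∀ a b, Neighbours a b → serre q (φ a) (φ b) = 0)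
  (hc : ∀ a b : Fin r, (a : ℕ) + 1 < b → φ a * φ b = φ b * φ a)

/-- Algebra maps out of `UMinus` from images of the generators. -/
def lift : UMinus r q →ₐ[ℂ] A :=
  RingQuot.liftAlgHom ℂ ⟨FreeAlgebra.lift ℂ φ, fun _ _ h => by
    induction h with
    | serre a b h => rw [map_serre, map_zero]; simpa using hs a b h
    | comm a b h => simpa using hc a b h⟩

lemma lift_f (a : Fin r) : lift φ hs hc (f q a) = φ a := by
  have h1 := RingQuot.liftAlgHom_mkAlgHom_apply ℂ (s := RelMinus r q) (FreeAlgebra.lift ℂ φ)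
    (fun _ _ h => by
      induction h with
      | serre a b h => rw [map_serre, map_zero]; simpa using hs a b h
      | comm a b h => simpa using hc a b h) (FreeAlgebra.ι ℂ a)
  exact h1.trans (by simp)

end Lift

lemma adjoin_range_f : Algebra.adjoin ℂ (Set.range (f q : Fin r → UMinus r q)) = ⊤ := by
  have h : Set.range (f q : Fin r → UMinus r q) = proj r q '' Set.range (FreeAlgebra.ι ℂ) := by
    rw [← Set.range_comp]; rfl
  rw [h, ← AlgHom.map_adjoin, FreeAlgebra.adjoin_range_ι, Algebra.map_top, AlgHom.range_eq_top]
  exact RingQuot.mkAlgHom_surjective ℂ (RelMinus r q)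

lemma mem_of_f_mul_mem {P : Submodule ℂ (UMinus r q)} (h1 : 1 ∈ P)
    (hf : ∀ a, ∀ y ∈ P, f q a * y ∈ P) (y : UMinus r q) : y ∈ P := by
  have := mem_of_mem_adjoin (Algebra.lmul ℂ (UMinus r q)) (s := Set.range (f q)) (P := P)
    (by rintro _ ⟨a, rfl⟩; exact hf a) (u := y) (by rw [adjoin_range_f]; trivial) 1 h1
  simpa using this

/-- Left multiplication by `f_{α_a}`. -/
def opF (q : ℂˣ) (a : Fin r) : Module.End ℂ (UMinus r q) := Algebra.lmul ℂ (UMinus r q) (f q a)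

/-- The kernel of `P - Q` contains `1` and is stable under left multiplication by the generators.
The scalars `c a` leave room for powers of `q`. The relations involving `K` or `e` alone are checked
on `UMinus` in this way. -/
lemma end_ext {P Q : Module.End ℂ (UMinus r q)} (h1 : P 1 = Q 1) (c : Fin r → ℂ)
    (h : ∀ a, (P - Q) * opF q a = c a • (opF q a * (P - Q))) : P = Q := by
  rw [← sub_eq_zero]
  refine LinearMap.ext fun y => ?_
  refine mem_of_f_mul_mem (P := LinearMap.ker (P - Q)) ?_ ?_ y
  · simp [h1]
  · intro a y hy
    rw [LinearMap.mem_ker] at hy ⊢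
    have := LinearMap.congr_fun (h a) y
    rw [Module.End.mul_apply, LinearMap.smul_apply, Module.End.mul_apply, hy, map_zero,
      smul_zero] at this
    exact this

/-! ### The action of the Cartan part -/

/-- The automorphism scaling the generators. -/
def scale (t : Fin r → ℂ) : UMinus r q →ₐ[ℂ] UMinus r q :=
  lift (fun a => t a • f q a) (fun a b h => by rw [serre_smul_smul, serre_f h, smul_zero])
    (fun a b h => by rw [smul_mul_smul_comm, f_mul_f h, smul_mul_smul_comm, mul_comm (t a)])

/-- The action of `q^{h_{ε_i}}` in the Verma module of highest weight `μ`. -/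
def opK (μ : Weight r) (i : Fin (r + 1)) : Module.End ℂ (UMinus r q) :=
  (μ i : ℂ) • (scale fun a => (q : ℂ) ^ (-pairing i a)).toLinearMap

/-- The action of `q^{-h_{ε_i}}` in the Verma module of highest weight `μ`. -/
def opKinv (μ : Weight r) (i : Fin (r + 1)) : Module.End ℂ (UMinus r q) :=
  (μ i : ℂ)⁻¹ • (scale fun a => (q : ℂ) ^ pairing i a).toLinearMap

variable {μ : Weight r}

lemma opK_one (i : Fin (r + 1)) : opK μ i (1 : UMinus r q) = (μ i : ℂ) • 1 := by
  simp [opK]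

lemma opKinv_one (i : Fin (r + 1)) : opKinv μ i (1 : UMinus r q) = (μ i : ℂ)⁻¹ • 1 := by
  simp [opKinv]

lemma opK_mul_opF (i : Fin (r + 1)) (a : Fin r) :
    opK μ i * opF q a = (q : ℂ) ^ (-pairing i a) • (opF q a * opK μ i) := by
  refine LinearMap.ext fun y => ?_
  simp [opK, opF, scale, lift_f, smul_comm (μ i : ℂ)]

lemma opKinv_mul_opF (i : Fin (r + 1)) (a : Fin r) :
    opKinv μ i * opF q a = (q : ℂ) ^ (pairing i a) • (opF q a * opKinv μ i) := by
  refine LinearMap.ext fun y => ?_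
  simp [opKinv, opF, scale, lift_f, smul_comm (μ i : ℂ)⁻¹]

lemma opK_mul_opKinv (i : Fin (r + 1)) : opK μ i * opKinv μ i = (1 : Module.End ℂ (UMinus r q)) := by
  refine end_ext (by simp [opK_one, opKinv_one]) 1 fun a => ?_
  rw [sub_mul, mul_assoc, opKinv_mul_opF, mul_smul_comm, ← mul_assoc, opK_mul_opF, smul_mul_assoc,
    smul_smul, ← zpow_add₀ q.ne_zero]
  simp [mul_sub, mul_assoc]

lemma opKinv_mul_opK (i : Fin (r + 1)) : opKinv μ i * opK μ i = (1 : Module.End ℂ (UMinus r q)) := by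
  refine end_ext (by simp [opK_one, opKinv_one]) 1 fun a => ?_
  rw [sub_mul, mul_assoc, opK_mul_opF, mul_smul_comm, ← mul_assoc, opKinv_mul_opF, smul_mul_assoc,
    smul_smul, ← zpow_add₀ q.ne_zero]
  simp [mul_sub, mul_assoc]

lemma opK_mul_opK (i j : Fin (r + 1)) :
    opK μ i * opK μ j = (opK μ j * opK μ i : Module.End ℂ (UMinus r q)) := by
  refine end_ext (by simp [opK_one, smul_smul, mul_comm])
    (fun a => (q : ℂ) ^ (-pairing i a) * (q : ℂ) ^ (-pairing j a)) fun a => ?_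
  have key (i j : Fin (r + 1)) : opK μ i * opK μ j * opF q a =
      ((q : ℂ) ^ (-pairing i a) * (q : ℂ) ^ (-pairing j a)) • (opF q a * (opK μ i * opK μ j)) := by
    rw [mul_assoc, opK_mul_opF, mul_smul_comm, ← mul_assoc, opK_mul_opF, smul_mul_assoc, smul_smul,
      mul_comm (_ ^ _), mul_assoc]
  rw [sub_mul, key i j, key j i, mul_comm ((q : ℂ) ^ (-pairing j a)), mul_sub, smul_sub]

/-- The action of `q^{h_α}`. -/
def opk (μ : Weight r) (a : Fin r) : Module.End ℂ (UMinus r q) :=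
  opK μ a.castSucc * opKinv μ a.succ

/-- The action of `q^{-h_α}`. -/
def opkinv (μ : Weight r) (a : Fin r) : Module.End ℂ (UMinus r q) :=
  opKinv μ a.castSucc * opK μ a.succ

lemma opk_mul_opF (a b : Fin r) :
    opk μ a * opF q b = (q : ℂ) ^ (-cartan a b) • (opF q b * opk μ a) := by
  rw [opk, mul_assoc, opKinv_mul_opF, mul_smul_comm, ← mul_assoc, opK_mul_opF, smul_mul_assoc,
    smul_smul, ← zpow_add₀ q.ne_zero, mul_assoc, cartan]
  congr 2; ring

lemma opkinv_mul_opF (a b : Fin r) :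
    opkinv μ a * opF q b = (q : ℂ) ^ (cartan a b) • (opF q b * opkinv μ a) := by
  rw [opkinv, mul_assoc, opK_mul_opF, mul_smul_comm, ← mul_assoc, opKinv_mul_opF, smul_mul_assoc,
    smul_smul, ← zpow_add₀ q.ne_zero, mul_assoc, cartan]
  congr 2; ring

/-- The action of `[h_α]_q`. -/
def opH (μ : Weight r) (a : Fin r) : Module.End ℂ (UMinus r q) :=
  ((q : ℂ) - (q : ℂ)⁻¹)⁻¹ • (opk μ a - opkinv μ a)

end UMinus

/-! ### Skew derivations and the Serre relations -/

section Serre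

variable {B : Type*} [Ring B] [Algebra ℂ B] {X Y k : B}

/-- Moving `k` to the right turns both sides into the same combination of `X Y k` and `Y X k`. The
identity is invariant under `t ↦ t⁻¹`, so it can be used for `q^{h}` and `q^{-h}` alike. It serves
the Serre relations both for the `f` and for the `e`. -/
lemma serre_derivation_left {t : ℂ} (ht : t ≠ 0) (hX : k * X = t ^ 2 • (X * k))
    (hY : k * Y = t⁻¹ • (Y * k)) :
    k * X * Y + X * k * Y + Y * k * X + Y * X * k = (t + t⁻¹) • (k * Y * X + X * Y * k) := by
  simp only [mul_assoc, hX, hY, mul_smul_comm, smul_mul_assoc, smul_smul, smul_add]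
  match_scalars <;> field_simp

lemma serre_derivation_right {t : ℂ} (ht : t ≠ 0) (hX : k * X = t⁻¹ • (X * k)) :
    X * X * k + k * X * X = (t + t⁻¹) • (X * k * X) := by
  simp only [mul_assoc, hX, mul_smul_comm, smul_mul_assoc, smul_smul]
  match_scalars; field_simp

end Serre

section Serre

variable {B : Type*} [Ring B] [Algebra ℂ B] {X Y k k' : B}

/-- The value on the Serre expression of the derivation sending `x` to `H = s (k - k')` and
`y` to `0`. -/
lemma serre_derivation_left_sub {t : ℂ} (ht : t ≠ 0) (s : ℂ) (hX : k * X = t ^ 2 • (X * k))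
    (hY : k * Y = t⁻¹ • (Y * k)) (hX' : k' * X = t⁻¹ ^ 2 • (X * k')) (hY' : k' * Y = t • (Y * k'))
    {H : B} (hH : H = s • (k - k')) :
    H * X * Y + X * H * Y + Y * H * X + Y * X * H = (t + t⁻¹) • (H * Y * X + X * Y * H) := by
  have h1 := serre_derivation_left ht hX hY
  have h2 := serre_derivation_left (inv_ne_zero ht) hX' (by rwa [inv_inv])
  rw [inv_inv, add_comm t⁻¹] at h2
  have h3 := congrArg (s • ·) (congrArg₂ (· - ·) h1 h2)
  simp only [hH, smul_mul_assoc, mul_smul_comm, sub_mul, mul_sub] at h3 ⊢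
  refine Eq.trans ?_ (h3.trans ?_) <;> module

/-- The value on the Serre expression of the derivation sending `x` to `0` and `y` to
`H = s (k - k')`. -/
lemma serre_derivation_right_sub {t : ℂ} (ht : t ≠ 0) (s : ℂ) (hX : k * X = t⁻¹ • (X * k))
    (hX' : k' * X = t • (X * k')) {H : B} (hH : H = s • (k - k')) :
    X * X * H + H * X * X = (t + t⁻¹) • (X * H * X) := by
  have h1 := serre_derivation_right ht hX
  have h2 := serre_derivation_right (k := k') (inv_ne_zero ht) (by rwa [inv_inv])
  rw [inv_inv, add_comm t⁻¹] at h2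
  have h3 := congrArg (s • ·) (congrArg₂ (· - ·) h1 h2)
  simp only [hH, smul_mul_assoc, mul_smul_comm, sub_mul, mul_sub] at h3 ⊢
  refine Eq.trans ?_ (h3.trans ?_) <;> module

/-- The commutator with `F` is a derivation sending `X` to `H` and `Y` to `0`; `hH` says that its
value on the Serre expression is zero. -/
lemma serre_mul_comm_of_left {X Y F H : B} (hX : X * F = F * X + H) (hY : Y * F = F * Y)
    (hH : H * X * Y + X * H * Y + Y * H * X + Y * X * H =
      ((q : ℂ) + (q : ℂ)⁻¹) • (H * Y * X + X * Y * H)) :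
    serre q X Y * F = F * serre q X Y := by
  have hX' (z : B) : X * (F * z) = F * (X * z) + H * z := by
    rw [← mul_assoc, hX, add_mul, mul_assoc]
  have hY' (z : B) : Y * (F * z) = F * (Y * z) := by rw [← mul_assoc, hY, mul_assoc]
  rw [← sub_eq_zero] at hH
  rw [← sub_eq_zero, ← hH]
  simp only [serre, mul_assoc, hX, hX', hY, hY', mul_add, add_mul, mul_sub, sub_mul,
    mul_smul_comm, smul_mul_assoc]
  module

lemma serre_mul_comm_of_right {X Y F H : B} (hX : X * F = F * X) (hY : Y * F = F * Y + H)
    (hH : X * X * H + H * X * X = ((q : ℂ) + (q : ℂ)⁻¹) • (X * H * X)) :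
    serre q X Y * F = F * serre q X Y := by
  have hY' (z : B) : Y * (F * z) = F * (Y * z) + H * z := by
    rw [← mul_assoc, hY, add_mul, mul_assoc]
  have hX' (z : B) : X * (F * z) = F * (X * z) := by rw [← mul_assoc, hX, mul_assoc]
  rw [← sub_eq_zero] at hH
  rw [← sub_eq_zero, ← hH]
  simp only [serre, mul_assoc, hX, hX', hY, hY', mul_add, add_mul, mul_sub, sub_mul,
    mul_smul_comm, smul_mul_assoc]
  module

lemma serre_mul_comm {X Y F : B} (hX : X * F = F * X) (hY : Y * F = F * Y) :
    serre q X Y * F = F * serre q X Y :=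
  serre_mul_comm_of_right (H := 0) hX (by simpa using hY) (by simp)

/-- Multiplication in the trivial square-zero extension encodes the Leibniz rule, so this is the
derivative of the Serre expression. -/
lemma snd_serre (x y : TrivSqZeroExt B B) :
    (serre q x y).snd =
      (x.fst * x.fst * y.snd + (x.fst * x.snd * y.fst + x.snd * x.fst * y.fst)) -
        ((q : ℂ) + (q : ℂ)⁻¹) •
          (x.fst * y.fst * x.snd + (x.fst * y.snd * x.fst + x.snd * y.fst * x.fst)) +
        (y.fst * x.fst * x.snd + (y.fst * x.snd * x.fst + y.snd * x.fst * x.fst)) := by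
  simp only [serre, TrivSqZeroExt.snd_sub, TrivSqZeroExt.snd_add, TrivSqZeroExt.snd_smul,
    TrivSqZeroExt.snd_mul, TrivSqZeroExt.fst_mul, smul_eq_mul, MulOpposite.smul_eq_mul_unop,
    MulOpposite.unop_op, mul_add, add_assoc, mul_assoc]

end Serre

namespace UMinus

variable {μ : Weight r}

lemma serre_opF {a b : Fin r} (h : Neighbours a b) : serre q (opF q a) (opF q b) = 0 := by
  rw [opF, opF, ← map_serre, serre_f h, map_zero]

lemma opF_mul_opF {a b : Fin r} (h : (a : ℕ) + 1 < b) :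
    opF q a * opF q b = opF q b * opF q a := by
  rw [opF, opF, ← map_mul, f_mul_f h, map_mul]

lemma opH_mul_opF_far {a b : Fin r} (h : cartan a b = 0) :
    opH μ a * opF q b = opF q b * opH μ a := by
  simp [opH, sub_mul, mul_sub, opk_mul_opF, opkinv_mul_opF, h]

/-! ### The action of `e_α` -/

open TrivSqZeroExt in
/-- The image of `f_{α_b}` under the algebra map that combines left multiplication with the
derivation `[e_{α_a}, ·]`. -/
def derGen (μ : Weight r) (a b : Fin r) :
    TrivSqZeroExt (Module.End ℂ (UMinus r q)) (Module.End ℂ (UMinus r q)) :=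
  inl (opF q b) + inr (if a = b then opH μ a else 0)

lemma fst_derGen (a b : Fin r) : (derGen μ a b).fst = opF q b := by
  rw [derGen, TrivSqZeroExt.fst_add, TrivSqZeroExt.fst_inl, TrivSqZeroExt.fst_inr, add_zero]

lemma snd_derGen (a b : Fin r) :
    (derGen μ a b).snd = (if a = b then opH μ a else 0 : Module.End ℂ (UMinus r q)) := by
  rw [derGen, TrivSqZeroExt.snd_add, TrivSqZeroExt.snd_inl, TrivSqZeroExt.snd_inr, zero_add]

/-- This makes the derivation well defined on `UMinus`. Its value on a Serre expression vanishes by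
the identities above with `t = q⁻¹`, since `q^{h_α}` passes `f_α` with the factor `q^{-2}`. -/
lemma serre_derGen (a : Fin r) {b d : Fin r} (h : Neighbours b d) :
    serre q (derGen μ a b) (derGen μ a d) = (0 : TrivSqZeroExt _ (Module.End ℂ (UMinus r q))) := by
  have hq := inv_ne_zero q.ne_zero
  have hbd : b ≠ d := by rintro rfl; unfold Neighbours at h; omega
  refine TrivSqZeroExt.ext ?_ ?_
  · simpa [serre, fst_derGen] using serre_opF (q := q) h
  · by_cases hab : a = b
    · subst hab
      have := serre_derivation_left_sub (H := opH μ a) (X := opF q a) (Y := opF q d) hq _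
        (by simpa [cartan_self] using opk_mul_opF (q := q) (μ := μ) a a)
        (by simpa [cartan_neighbours h] using opk_mul_opF (q := q) (μ := μ) a d)
        (by simpa [cartan_self] using opkinv_mul_opF (q := q) (μ := μ) a a)
        (by simpa [cartan_neighbours h] using opkinv_mul_opF (q := q) (μ := μ) a d) rfl
      rw [inv_inv, ← sub_eq_zero] at this
      rw [snd_serre, TrivSqZeroExt.snd_zero, ← this]
      simp only [fst_derGen, snd_derGen, if_pos, if_neg hbd, mul_zero, zero_mul]
      module
    · by_cases had : a = d
      · subst had
        have hc : cartan a b = -1 := by rw [cartan_symm, cartan_neighbours h]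
        have := serre_derivation_right_sub (H := opH μ a) (X := opF q b) hq _
          (by simpa [hc] using opk_mul_opF (q := q) (μ := μ) a b)
          (by simpa [hc] using opkinv_mul_opF (q := q) (μ := μ) a b) rfl
        rw [inv_inv, ← sub_eq_zero] at this
        rw [snd_serre, TrivSqZeroExt.snd_zero, ← this]
        simp only [fst_derGen, snd_derGen, if_pos, if_neg hab, mul_zero, zero_mul]
        module
      · simp [serre, fst_derGen, snd_derGen, hab, had]

lemma derGen_mul_derGen (a : Fin r) {b d : Fin r} (h : (b : ℕ) + 1 < d) :
    derGen μ a b * derGen μ a d =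
      (derGen μ a d * derGen μ a b : TrivSqZeroExt _ (Module.End ℂ (UMinus r q))) := by
  refine TrivSqZeroExt.ext ?_ ?_
  · simpa [fst_derGen, snd_derGen] using opF_mul_opF (q := q) h
  · by_cases hab : a = b
    · subst hab
      have had : a ≠ d := by rintro rfl; omega
      simpa [fst_derGen, snd_derGen, had] using opH_mul_opF_far (cartan_far h)
    · by_cases had : a = d
      · subst had
        simpa [fst_derGen, snd_derGen, hab] using (opH_mul_opF_far (by rw [cartan_symm, cartan_far h])).symm
      · simp [fst_derGen, snd_derGen, hab, had]

/-- Left multiplication together with the derivation `[e_{α_a}, ·]`. -/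
def der (μ : Weight r) (a : Fin r) :
    UMinus r q →ₐ[ℂ] TrivSqZeroExt (Module.End ℂ (UMinus r q)) (Module.End ℂ (UMinus r q)) :=
  lift (derGen μ a) (fun _ _ h => serre_derGen a h) fun _ _ h => derGen_mul_derGen a h

/-- The action of `e_{α_a}` in the Verma module of highest weight `μ`. -/
def opE (μ : Weight r) (a : Fin r) : Module.End ℂ (UMinus r q) where
  -- The second component plays the role of the commutator of `e` with left multiplication by `y`.
  -- Evaluated at `1`, which `e` must kill, it gives `e · y`.
  toFun y := (der μ a y).snd 1
  map_add' y z := by simp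
  map_smul' c y := by simp

lemma fst_der (a : Fin r) (y : UMinus r q) : (der μ a y).fst = Algebra.lmul ℂ _ y := by
  refine mem_of_f_mul_mem (P := LinearMap.eqLocus
    ((TrivSqZeroExt.fstHom ℂ _ _).toLinearMap ∘ₗ (der μ a).toLinearMap)
    (Algebra.lmul ℂ (UMinus r q)).toLinearMap) ?_ ?_ y
  · change (der μ a 1).fst = Algebra.lmul ℂ _ 1
    rw [map_one, map_one, TrivSqZeroExt.fst_one]
  · intro b y hy
    have hy' : (der μ a y).fst = Algebra.lmul ℂ _ y := hy
    change (der μ a (f q b * y)).fst = Algebra.lmul ℂ _ (f q b * y)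
    rw [map_mul, TrivSqZeroExt.fst_mul, hy', map_mul, der, lift_f, fst_derGen, opF]

lemma opE_one (a : Fin r) : opE μ a (1 : UMinus r q) = 0 := by simp [opE]

lemma opE_mul_opF (a b : Fin r) :
    opE μ a * opF q b = opF q b * opE μ a + if a = b then opH μ a else 0 := by
  refine LinearMap.ext fun y => ?_
  have h : (der μ a (f q b * y)).snd =
      opF q b * (der μ a y).snd + (if a = b then opH μ a else 0) * Algebra.lmul ℂ _ y := by
    rw [map_mul, TrivSqZeroExt.snd_mul, fst_der a y]
    rw [der, lift_f, fst_derGen, snd_derGen]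
    rfl
  change (der μ a (f q b * y)).snd 1 = opF q b ((der μ a y).snd 1) +
    (if a = b then opH μ a else 0 : Module.End ℂ (UMinus r q)) y
  rw [h, LinearMap.add_apply, Module.End.mul_apply, Module.End.mul_apply]
  simp

end UMinus

namespace UMinus

variable {μ : Weight r}

/-! ### The Verma module structure -/

lemma opK_mul_opk (i : Fin (r + 1)) (a : Fin r) :
    opK μ i * opk μ a = (opk μ a * opK μ i : Module.End ℂ (UMinus r q)) := by
  have h : opKinv μ a.succ * opK μ i = (opK μ i * opKinv μ a.succ : Module.End ℂ (UMinus r q)) := by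
    simpa using comm_inv one_ne_zero (opK_mul_opKinv (q := q) (μ := μ) a.succ) (opKinv_mul_opK _)
      (z := opK μ i) (by simpa using opK_mul_opK a.succ i)
  rw [opk, ← mul_assoc, opK_mul_opK, mul_assoc, ← h, mul_assoc]

lemma opK_mul_opkinv (i : Fin (r + 1)) (a : Fin r) :
    opK μ i * opkinv μ a = (opkinv μ a * opK μ i : Module.End ℂ (UMinus r q)) := by
  have h : opKinv μ a.castSucc * opK μ i =
      (opK μ i * opKinv μ a.castSucc : Module.End ℂ (UMinus r q)) := by
    simpa using comm_inv one_ne_zero (opK_mul_opKinv (q := q) (μ := μ) a.castSucc)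
      (opKinv_mul_opK _) (z := opK μ i) (by simpa using opK_mul_opK a.castSucc i)
  rw [opkinv, ← mul_assoc, ← h, mul_assoc, opK_mul_opK, mul_assoc]

lemma opK_mul_opH (i : Fin (r + 1)) (a : Fin r) :
    opK μ i * opH μ a = (opH μ a * opK μ i : Module.End ℂ (UMinus r q)) := by
  rw [opH, mul_smul_comm, smul_mul_assoc, mul_sub, sub_mul, opK_mul_opk, opK_mul_opkinv]

lemma opK_mul_opE (i : Fin (r + 1)) (a : Fin r) :
    opK μ i * opE μ a = (q : ℂ) ^ pairing i a • (opE μ a * opK μ i :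
      Module.End ℂ (UMinus r q)) := by
  have hq := q.ne_zero
  refine end_ext (by simp [opK_one, opE_one]) (fun b => (q : ℂ) ^ (-pairing i b)) fun b => ?_
  have h1 : opK μ i * opE μ a * opF q b = (q : ℂ) ^ (-pairing i b) •
      (opF q b * (opK μ i * opE μ a)) + opK μ i * (if a = b then opH μ a else 0) := by
    rw [mul_assoc, opE_mul_opF, mul_add, ← mul_assoc, opK_mul_opF, smul_mul_assoc, mul_assoc]
  have h2 : opE μ a * opK μ i * opF q b = (q : ℂ) ^ (-pairing i b) •
      (opF q b * (opE μ a * opK μ i) + (if a = b then opH μ a else 0) * opK μ i) := by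
    rw [mul_assoc, opK_mul_opF, mul_smul_comm, ← mul_assoc, opE_mul_opF, add_mul, mul_assoc]
  rw [sub_mul, smul_mul_assoc, h1, h2, mul_sub, mul_smul_comm]
  by_cases hab : a = b
  · subst hab
    rw [if_pos rfl, opK_mul_opH, smul_add, smul_add, smul_smul _ _ (opH μ a * opK μ i),
      ← zpow_add₀ hq, add_neg_cancel, zpow_zero]
    module
  · simp only [if_neg hab, mul_zero, zero_mul, add_zero]
    module

lemma opKinv_mul_opE (i : Fin (r + 1)) (a : Fin r) :
    opKinv μ i * opE μ a = (q : ℂ) ^ (-pairing i a) • (opE μ a * opKinv μ i :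
      Module.End ℂ (UMinus r q)) := by
  rw [comm_inv (zpow_ne_zero _ q.ne_zero) (opK_mul_opKinv i) (opKinv_mul_opK i) (opK_mul_opE i a),
    zpow_neg]

lemma opk_mul_opE (a b : Fin r) :
    opk μ a * opE μ b = (q : ℂ) ^ cartan a b • (opE μ b * opk μ a : Module.End ℂ (UMinus r q)) := by
  rw [opk, mul_assoc, opKinv_mul_opE, mul_smul_comm, ← mul_assoc, opK_mul_opE, smul_mul_assoc,
    smul_smul, ← zpow_add₀ q.ne_zero, mul_assoc, cartan]
  congr 2; ring

lemma opkinv_mul_opE (a b : Fin r) :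
    opkinv μ a * opE μ b =
      (q : ℂ) ^ (-cartan a b) • (opE μ b * opkinv μ a : Module.End ℂ (UMinus r q)) := by
  rw [opkinv, mul_assoc, opK_mul_opE, mul_smul_comm, ← mul_assoc, opKinv_mul_opE, smul_mul_assoc,
    smul_smul, ← zpow_add₀ q.ne_zero, mul_assoc, cartan]
  congr 2; ring

lemma opH_mul_opE_far {a b : Fin r} (h : cartan a b = 0) :
    opH μ a * opE μ b = (opE μ b * opH μ a : Module.End ℂ (UMinus r q)) := by
  simp [opH, sub_mul, mul_sub, opk_mul_opE, opkinv_mul_opE, h]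

lemma opE_mul_opE {a b : Fin r} (h : (a : ℕ) + 1 < b) :
    opE μ a * opE μ b = (opE μ b * opE μ a : Module.End ℂ (UMinus r q)) := by
  refine end_ext (by simp [opE_one]) 1 fun d => ?_
  have key (a b : Fin r) : opE μ a * opE μ b * opF q d = opF q d * (opE μ a * opE μ b) +
      ((if a = d then opH μ a else 0) * opE μ b + opE μ a * (if b = d then opH μ b else 0)) := by
    rw [mul_assoc, opE_mul_opF, mul_add, ← mul_assoc, opE_mul_opF, add_mul, mul_assoc, add_assoc]
  rw [sub_mul, key a b, key b a, mul_sub, Pi.one_apply, one_smul]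
  have h1 : (if a = d then opH μ a else 0) * opE μ b =
      (opE μ b * (if a = d then opH μ a else 0) : Module.End ℂ (UMinus r q)) := by
    split_ifs
    · exact opH_mul_opE_far (cartan_far h)
    · simp
  have h2 : (if b = d then opH μ b else 0) * opE μ a =
      (opE μ a * (if b = d then opH μ b else 0) : Module.End ℂ (UMinus r q)) := by
    split_ifs
    · exact opH_mul_opE_far (by rw [cartan_symm, cartan_far h])
    · simp
  rw [h1, h2]
  abel

/-- The Serre expression in the `e` kills `1` and commutes with every left multiplication by an `f`,
hence is zero. -/
lemma serre_opE {a b : Fin r} (h : Neighbours a b) :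
    serre q (opE μ a) (opE μ b) = (0 : Module.End ℂ (UMinus r q)) := by
  have hq := q.ne_zero
  have hab : a ≠ b := by rintro rfl; unfold Neighbours at h; omega
  have hba : cartan b a = -1 := by rw [cartan_symm, cartan_neighbours h]
  refine end_ext (by simp [serre, opE_one]) 1 fun d => ?_
  rw [sub_zero, Pi.one_apply, one_smul]
  have hE (a : Fin r) (h : a ≠ d) : opE μ a * opF q d = opF q d * opE μ a := by
    rw [opE_mul_opF, if_neg h, add_zero]
  have hE' (a : Fin r) (h : a = d) : opE μ a * opF q d = opF q d * opE μ a + opH μ a := by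
    rw [opE_mul_opF, if_pos h]
  by_cases had : a = d
  · refine serre_mul_comm_of_left (hE' a had) (hE b (had ▸ hab.symm)) ?_
    exact serre_derivation_left_sub hq _
      (by simpa [cartan_self] using opk_mul_opE (q := q) (μ := μ) a a)
      (by simpa [cartan_neighbours h] using opk_mul_opE (q := q) (μ := μ) a b)
      (by simpa [cartan_self] using opkinv_mul_opE (q := q) (μ := μ) a a)
      (by simpa [cartan_neighbours h] using opkinv_mul_opE (q := q) (μ := μ) a b) rfl
  · by_cases hbd : b = d
    · refine serre_mul_comm_of_right (hE a had) (hE' b hbd) ?_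
      exact serre_derivation_right_sub hq _
        (by simpa [hba] using opk_mul_opE (q := q) (μ := μ) b a)
        (by simpa [hba] using opkinv_mul_opE (q := q) (μ := μ) b a) rfl
    · exact serre_mul_comm (hE a had) (hE b hbd)

/-- The operators by which the generators of `U_q` act in the Verma module of highest
weight `μ`. -/
def opGen (q : ℂˣ) (μ : Weight r) : Gen r → Module.End ℂ (UMinus r q)
  | .K i => opK μ i
  | .Kinv i => opKinv μ i
  | .e a => opE μ a
  | .f a => opF q a

lemma opGen_rel (hq : (q : ℂ) - (q : ℂ)⁻¹ ≠ 0) (μ : Weight r) ⦃x y : FreeAlgebra ℂ (Gen r)⦄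
    (h : Rel r q x y) :
    FreeAlgebra.lift ℂ (opGen q μ) x = FreeAlgebra.lift ℂ (opGen q μ) y := by
  induction h with
  | K_Kinv i => simpa [opGen] using opK_mul_opKinv i
  | Kinv_K i => simpa [opGen] using opKinv_mul_opK i
  | K_K i j => simpa [opGen] using opK_mul_opK i j
  | K_e i a => simpa [opGen] using opK_mul_opE i a
  | K_f i a => simpa [opGen] using opK_mul_opF i a
  | e_f_self a =>
    simp only [map_smul, map_sub, map_mul, FreeAlgebra.lift_ι_apply, opGen]
    rw [opE_mul_opF, if_pos rfl, add_sub_cancel_left, opH, smul_inv_smul₀ hq]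
    rfl
  | e_f_ne a b h => simpa [opGen, h] using opE_mul_opF (q := q) (μ := μ) a b
  | e_serre a b h => rw [map_serre, map_zero]; simpa [opGen] using serre_opE h
  | f_serre a b h => rw [map_serre, map_zero]; simpa [opGen] using serre_opF h
  | e_e a b h => simpa [opGen] using opE_mul_opE h
  | f_f a b h => simpa [opGen] using opF_mul_opF h

/-- The representation of `U_q` on `UMinus` that makes it the Verma module of highest
weight `μ`. -/
def vermaRep (hq : (q : ℂ) - (q : ℂ)⁻¹ ≠ 0) (μ : Weight r) :
    Uq r q →ₐ[ℂ] Module.End ℂ (UMinus r q) :=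
  QuantumGL.lift (opGen q μ) (opGen_rel hq μ)

/-- The map from `UMinus` to `U_q`. -/
def toUq (r : ℕ) (q : ℂˣ) : UMinus r q →ₐ[ℂ] Uq r q :=
  lift (QuantumGL.f q) (fun _ _ h => QuantumGL.f_serre h) fun _ _ h => QuantumGL.f_f h

end UMinus

/-! ### Verma modules as modules over the `f_α` -/

section Universal

variable {M : Type} [AddCommGroup M] [Module ℂ M] [Module (Uq r q) M] [IsScalarTower ℂ (Uq r q) M]

/-- The linear map induced on the quotient by a submodule over a `ℂ`-algebra. -/
def liftRestrict {U : Type*} [Ring U] [Algebra ℂ U] {L N : Type*} [AddCommGroup L] [Module ℂ L]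
    [Module U L] [IsScalarTower ℂ U L] [AddCommGroup N] [Module ℂ N] (p : Submodule U L)
    (g : L →ₗ[ℂ] N) (h : ∀ x ∈ p, g x = 0) : L ⧸ p →ₗ[ℂ] N :=
  (Submodule.liftQ (p.restrictScalars ℂ) g h) ∘ₗ
    (Submodule.Quotient.restrictScalarsEquiv ℂ p).symm.toLinearMap

lemma liftRestrict_mkQ {U : Type*} [Ring U] [Algebra ℂ U] {L N : Type*} [AddCommGroup L]
    [Module ℂ L] [Module U L] [IsScalarTower ℂ U L] [AddCommGroup N] [Module ℂ N]
    (p : Submodule U L) (g : L →ₗ[ℂ] N) (h : ∀ x ∈ p, g x = 0) (x : L) :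
    liftRestrict p g h (p.mkQ x) = g x := rfl

open UMinus in
-- The map is the composite of `u · v_μ ↦ u · 1 ∈ UMinus` with `y ↦ y · v`. No triangular
-- decomposition of `U_q` enters, and `v` is arbitrary because only compatibility with the `f_α` is
-- asked for.
lemma exists_linearMap_verma (hq : (q : ℂ) - (q : ℂ)⁻¹ ≠ 0) (μ : Weight r) (v : M) :
    ∃ g : Verma q μ →ₗ[ℂ] M, g (vermaVec q μ) = v ∧ ∀ (a : Fin r) x, g (f q a • x) = f q a • g x := by
  let φ : Uq r q →ₗ[ℂ] UMinus r q := LinearMap.applyₗ 1 ∘ₗ (vermaRep hq μ).toLinearMap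
  have hφ (u u' : Uq r q) : φ (u * u') = vermaRep hq μ u (φ u') := by simp [φ]
  let ψ : UMinus r q →ₗ[ℂ] M :=
    (LinearMap.toSpanSingleton (Uq r q) M v).restrictScalars ℂ ∘ₗ (toUq r q).toLinearMap
  have hψ (a : Fin r) (y : UMinus r q) : ψ (UMinus.f q a * y) = QuantumGL.f q a • ψ y := by
    simp [ψ, toUq, lift_f, mul_smul]
  -- The annihilator of `1` is a left ideal, so it suffices that the generators of `vermaIdeal` act
  -- by zero on `1 ∈ UMinus`.
  have hker : ∀ u ∈ vermaIdeal q μ, φ u = 0 := by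
    intro u hu
    induction hu using Submodule.span_induction with
    | mem u hu =>
      rcases hu with ⟨a, rfl⟩ | ⟨i, rfl⟩
      · simpa [φ, vermaRep, lift_gen, opGen] using opE_one a
      · simp [φ, vermaRep, lift_gen, opGen, opK_one, Module.algebraMap_end_apply]
    | zero => simp
    | add u u' _ _ hu hu' => rw [map_add, hu, hu', add_zero]
    | smul u u' _ hu' => rw [smul_eq_mul, hφ, hu', map_zero]
  refine ⟨liftRestrict _ (ψ ∘ₗ φ) fun u hu => ?_, ?_, fun a x => ?_⟩
  · rw [LinearMap.comp_apply, hker u hu, map_zero]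
  · rw [vermaVec, liftRestrict_mkQ]
    simp [φ, ψ]
  · obtain ⟨u, rfl⟩ := Submodule.mkQ_surjective _ x
    rw [← map_smul, liftRestrict_mkQ, liftRestrict_mkQ]
    change ψ (φ (QuantumGL.f q a * u)) = QuantumGL.f q a • ψ (φ u)
    rw [hφ, ← hψ, vermaRep, lift_gen]
    rfl

end Universal

/-! ### Comparing highest weight modules of different weights over the `f_α`. -/

section Highest

variable {M N : Type} [AddCommGroup M] [Module ℂ M] [Module (Uq r q) M]
  [IsScalarTower ℂ (Uq r q) M] [AddCommGroup N] [Module ℂ N] [Module (Uq r q) N]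
  [IsScalarTower ℂ (Uq r q) N] {μ μ' : Weight r} {v : M} {v' : N}

lemma uq_lsmul_apply (u : Uq r q) (x : M) : Algebra.lsmul ℂ ℂ M u x = u • x := rfl

lemma IsHighest.k_smul (h : IsHighest q μ v) (a : Fin r) :
    k q a • v = ((μ a.succ : ℂ)⁻¹ * μ a.castSucc) • v := by
  rw [k, mul_smul, h.Kinv_smul, uq_smul_comm, h.K_smul, smul_smul]

/-- The commutator `[e_α, f_α]` acts on `v` by a multiple of the difference of the eigenvalues of
`q^{h_α}` and `q^{-h_α}`, both equal to `1` here. -/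
lemma IsHighest.e_smul_f_smul (h : IsHighest q μ v) (hq : (q : ℂ) - (q : ℂ)⁻¹ ≠ 0) {b : Fin r}
    (hb : μ b.castSucc = μ b.succ) (a : Fin r) : e q a • f q b • v = 0 := by
  by_cases hab : a = b
  · subst hab
    have h1 := congrArg (· • v) (e_f_self (q := q) a)
    simp only [sub_smul, mul_smul, smul_assoc, h.e_smul, smul_zero, sub_zero, h.k_smul,
      h.kinv_smul, hb, mul_comm, sub_self] at h1
    rw [← sub_smul] at h1
    exact (smul_eq_zero.1 h1).resolve_left hq
  · rw [smul_smul, e_f_ne hab, mul_smul, h.e_smul, smul_zero]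

lemma IsHighest.mem_of_f_smul_mem (h : IsHighest q μ v) (hq : (q : ℂ) - (q : ℂ)⁻¹ ≠ 0)
    {P : Submodule ℂ M} (hv : v ∈ P) (hf : ∀ (a : Fin r), ∀ x ∈ P, f q a • x ∈ P) (x : M) :
    x ∈ P := by
  have hle : nSpan (Algebra.lsmul ℂ ℂ M : Uq r q →ₐ[ℂ] _) {v} ≤ P :=
    nSpan_le (by rintro _ rfl; exact hv) hf
  refine hle ?_
  have hx : x ∈ Submodule.span (Uq r q) {v} := by rw [h.span_eq]; trivial
  obtain ⟨u, rfl⟩ := Submodule.mem_span_singleton.1 hx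
  have hv' : v ∈ nSpan (Algebra.lsmul ℂ ℂ M : Uq r q →ₐ[ℂ] _) {v} := subset_nSpan rfl
  refine nSpan_stable hq ?_ ?_ ?_ u v hv'
  · rintro i _ rfl
    rw [uq_lsmul_apply, h.K_smul]
    exact Submodule.smul_mem _ _ hv'
  · rintro i _ rfl
    rw [uq_lsmul_apply, h.Kinv_smul]
    exact Submodule.smul_mem _ _ hv'
  · rintro a _ rfl
    rw [uq_lsmul_apply, h.e_smul]
    exact zero_mem _

/-- A linear map between highest weight modules that commutes with the `f_α` commutes with
`q^{-h_α}` up to a scalar. -/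
lemma IsHighest.map_kinv_smul (h : IsHighest q μ v) (h' : IsHighest q μ' v')
    (hq : (q : ℂ) - (q : ℂ)⁻¹ ≠ 0) {g : M →ₗ[ℂ] N} (hv : g v = v')
    (hf : ∀ (a : Fin r) x, g (f q a • x) = f q a • g x) (a : Fin r) (x : M) :
    g (kinv q a • x) = (((μ a.succ : ℂ) * (μ a.castSucc : ℂ)⁻¹) *
      ((μ' a.succ : ℂ) * (μ' a.castSucc : ℂ)⁻¹)⁻¹) • kinv q a • g x := by
  set s : ℂ := ((μ a.succ : ℂ) * (μ a.castSucc : ℂ)⁻¹) *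
    ((μ' a.succ : ℂ) * (μ' a.castSucc : ℂ)⁻¹)⁻¹ with hs
  -- On both sides `q^{-h_α}` passes each `f` with the same power of `q`, so it is enough to compare
  -- at `v`, where `s` is the ratio of the two eigenvalues.
  refine h.mem_of_f_smul_mem hq (P := LinearMap.eqLocus (g ∘ₗ Algebra.lsmul ℂ ℂ M (kinv q a))
    (s • (Algebra.lsmul ℂ ℂ N (kinv q a) ∘ₗ g))) ?_ ?_ x
  · change g (kinv q a • v) = s • kinv q a • g v
    rw [hs, h.kinv_smul, map_smul, hv, h'.kinv_smul, smul_smul, inv_mul_cancel_right₀ (by simp)]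
  · intro b y hy
    replace hy : g (kinv q a • y) = s • kinv q a • g y := hy
    change g (kinv q a • f q b • y) = s • kinv q a • g (f q b • y)
    rw [hf, smul_smul, smul_smul (kinv q a) (f q b), kinv_mul_f, smul_assoc, smul_assoc, mul_smul,
      mul_smul (f q b), map_smul, hf, hy, uq_smul_comm, smul_comm]

/-- Scaling the basis vector `w_i` by `μ'_i / μ_i`. -/
def diagEquiv (μ μ' : Weight r) : (Fin (r + 1) → ℂ) ≃ₗ[ℂ] (Fin (r + 1) → ℂ) :=
  LinearEquiv.piCongrRight fun i => LinearEquiv.smulOfUnit (μ' i / μ i)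

lemma diagEquiv_single (μ μ' : Weight r) (i : Fin (r + 1)) :
    diagEquiv μ μ' (Pi.single i 1) = ((μ' i : ℂ) / μ i) • Pi.single i 1 := by
  ext j
  by_cases hij : j = i
  · subst hij
    simp only [diagEquiv, LinearEquiv.piCongrRight_apply, Pi.smul_apply, Pi.single_eq_same]
    change ((μ' j / μ j : ℂˣ) : ℂ) • (1 : ℂ) = _
    simp
  · simp [diagEquiv, hij]

/-- The isomorphism of `ℂ^n ⊗ M` and `ℂ^n ⊗ N` induced by one of `M` and `N` that commutes with
the `f_α`. -/
def tensorEquiv (μ μ' : Weight r) (g : M ≃ₗ[ℂ] N) :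
    (Fin (r + 1) → ℂ) ⊗[ℂ] M ≃ₗ[ℂ] (Fin (r + 1) → ℂ) ⊗[ℂ] N :=
  TensorProduct.congr (diagEquiv μ μ') g

lemma tensorEquiv_single (g : M ≃ₗ[ℂ] N) (i : Fin (r + 1)) (x : M) :
    tensorEquiv μ μ' g (Pi.single i 1 ⊗ₜ x) = ((μ' i : ℂ) / μ i) • (Pi.single i 1 ⊗ₜ g x) := by
  rw [tensorEquiv, TensorProduct.congr_tmul, diagEquiv_single, TensorProduct.smul_tmul']

/-- The summand `f_α ⊗ q^{-h_α}` sends `w_a` to `w_{a+1}`, and `g` commutes with `q^{-h_α}` up to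
`(μ_{a+1}/μ_a)(μ'_a/μ'_{a+1})`. This is the ratio of the scalings of `w_a` and `w_{a+1}` in
`diagEquiv`. -/
lemma IsHighest.tensorEquiv_f (h : IsHighest q μ v) (h' : IsHighest q μ' v')
    (hq : (q : ℂ) - (q : ℂ)⁻¹ ≠ 0) {g : M ≃ₗ[ℂ] N} (hv : g v = v')
    (hf : ∀ (a : Fin r) x, g (f q a • x) = f q a • g x) (a : Fin r)
    (x : (Fin (r + 1) → ℂ) ⊗[ℂ] M) :
    tensorEquiv μ μ' g (tensorRep r q M (f q a) x) =
      tensorRep r q N (f q a) (tensorEquiv μ μ' g x) := by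
  suffices H : (tensorEquiv μ μ' g).toLinearMap ∘ₗ tensorRep r q M (f q a) =
      tensorRep r q N (f q a) ∘ₗ (tensorEquiv μ μ' g).toLinearMap from LinearMap.congr_fun H x
  refine TensorProduct.ext (LinearMap.pi_ext' fun i => LinearMap.ext_ring (LinearMap.ext fun x => ?_))
  change tensorEquiv μ μ' g (tensorRep r q M (f q a) (Pi.single i 1 ⊗ₜ x)) =
    tensorRep r q N (f q a) (tensorEquiv μ μ' g (Pi.single i 1 ⊗ₜ x))
  rw [tensorEquiv_single, map_smul, tensorRep_f, tensorRep_f, map_add, tensorEquiv_single, hf,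
    smul_add]
  congr 1
  by_cases hi : a.castSucc = i
  · subst hi
    have hk := h.map_kinv_smul h' hq (g := g.toLinearMap) hv hf a x
    rw [LinearEquiv.coe_coe] at hk
    rw [natRep_f_castSucc, tensorEquiv_single, hk, TensorProduct.tmul_smul, smul_smul]
    congr 1
    have := (μ a.succ).ne_zero
    have := (μ a.castSucc).ne_zero
    have := (μ' a.succ).ne_zero
    have := (μ' a.castSucc).ne_zero
    field_simp
  · rw [natRep_f_of_ne hi, TensorProduct.zero_tmul, TensorProduct.zero_tmul, map_zero, smul_zero]

lemma map_nMinus {X Y : Type*} [AddCommGroup X] [Module ℂ X] [AddCommGroup Y] [Module ℂ Y]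
    {R : Uq r q →ₐ[ℂ] Module.End ℂ X} {R' : Uq r q →ₐ[ℂ] Module.End ℂ Y} {φ : X →ₗ[ℂ] Y}
    (hf : ∀ a x, φ (R (f q a) x) = R' (f q a) (φ x)) {y : Uq r q} (hy : y ∈ nMinus r q) :
    ∀ x, φ (R y x) = R' y (φ x) := by
  induction hy using Algebra.adjoin_induction with
  | mem u hu => obtain ⟨a, rfl⟩ := hu; exact hf a
  | algebraMap c => intro x; simp [Module.algebraMap_end_apply]
  | add u u' _ _ hu hu' => intro x; simp [hu, hu']
  | mul u u' _ _ hu hu' => intro x; simp [hu, hu']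

lemma tensorEquiv_map_filt {g : M ≃ₗ[ℂ] N} (hv : g v = v')
    (hf : ∀ (a : Fin r) x, tensorEquiv μ μ' g (tensorRep r q M (f q a) x) =
      tensorRep r q N (f q a) (tensorEquiv μ μ' g x)) (j : ℕ) :
    (filt r q v j).map (tensorEquiv μ μ' g).toLinearMap = filt r q v' j := by
  refine le_antisymm (Submodule.map_le_iff_le_comap.2 (nSpan_le ?_ ?_)) (nSpan_le ?_ ?_)
  · rintro _ ⟨i, hi, rfl⟩
    rw [Submodule.mem_comap, LinearEquiv.coe_coe, tensorEquiv_single, hv]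
    exact Submodule.smul_mem _ _ (single_mem_filt hi)
  · intro a x hx
    rw [Submodule.mem_comap, LinearEquiv.coe_coe, hf]
    exact f_nSpan a hx
  · rintro _ ⟨i, hi, rfl⟩
    have hd : (μ' i : ℂ) / μ i ≠ 0 := div_ne_zero (μ' i).ne_zero (μ i).ne_zero
    rw [← Submodule.smul_mem_iff _ hd, ← hv, ← tensorEquiv_single]
    exact ⟨_, single_mem_filt hi, rfl⟩
  · rintro a _ ⟨x, hx, rfl⟩
    exact ⟨_, f_nSpan a hx, hf a x⟩

end Highest

/-! ### Independence of `λ` -/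

variable {c : Composition (r + 1)} {σ : Equiv.Perm (Fin (r + 1))} {lam lam' : Weight r}

/-- Both ends of the root are moved by `σ` through the same distance, so the `ρ`-shifts agree. -/
lemma dot_castSucc_eq_succ {a b : Fin r} (ha : lam a.castSucc = lam a.succ)
    (h1 : σ a.castSucc = b.castSucc) (h2 : σ a.succ = b.succ) :
    dot q σ lam b.castSucc = dot q σ lam b.succ := by
  have h3 (x : Fin (r + 1)) : σ⁻¹ (σ x) = x := σ.symm_apply_apply x
  rw [dot, dot, ← h1, ← h2, h3, h3, ha, h1, h2]
  congr 2
  simp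

/-- The generators are vectors `f_b v` killed by all `e_α`, so `U_q(n_-)` alone generates the same
submodule. A map that commutes only with the `f_α` can thus be shown to kill it. -/
lemma singSub_le_nSpan (hq : (q : ℂ) - (q : ℂ)⁻¹ ≠ 0) (hs : MapsSimpleToSimple c σ)
    (hlam : IsCentral c lam) {x : Verma q (dot q σ lam)} (hx : x ∈ singSub q c σ lam) :
    x ∈ nSpan (Algebra.lsmul ℂ ℂ (Verma q (dot q σ lam)) : Uq r q →ₐ[ℂ] _)
      {x | ∃ a ∈ leviRoots c,
        x = dynRoot q (σ a.castSucc) (σ a.succ) • vermaVec q (dot q σ lam)} := by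
  have h := isHighest_vermaVec (q := q) (dot q σ lam)
  have hst := nSpan_stable (r := r) (q := q) (R := Algebra.lsmul ℂ ℂ (Verma q (dot q σ lam)))
    (W := {x | ∃ a ∈ leviRoots c,
        x = dynRoot q (σ a.castSucc) (σ a.succ) • vermaVec q (dot q σ lam)}) hq ?_ ?_ ?_
  · induction hx using Submodule.span_induction with
    | mem x hx => exact subset_nSpan hx
    | zero => exact zero_mem _
    | add x y _ _ hx hy => exact add_mem hx hy
    | smul u x _ hx => exact hst u x hx
  all_goals
    rintro i _ ⟨a, ha, rfl⟩
    obtain ⟨b, h1, h2⟩ := hs a ha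
    have hmem : f q b • vermaVec q (dot q σ lam) ∈ nSpan
        (Algebra.lsmul ℂ ℂ (Verma q (dot q σ lam)) : Uq r q →ₐ[ℂ] _) {x | ∃ a ∈ leviRoots c,
          x = dynRoot q (σ a.castSucc) (σ a.succ) • vermaVec q (dot q σ lam)} :=
      subset_nSpan ⟨a, ha, by rw [h1, h2, dynRoot_castSucc_succ]⟩
    rw [h1, h2, dynRoot_castSucc_succ, uq_lsmul_apply]
  · rw [smul_smul, K_mul_f, smul_assoc, mul_smul, h.K_smul, uq_smul_comm]
    exact Submodule.smul_mem _ _ (Submodule.smul_mem _ _ hmem)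
  · rw [smul_smul, Kinv_mul_f, smul_assoc, mul_smul, h.Kinv_smul, uq_smul_comm]
    exact Submodule.smul_mem _ _ (Submodule.smul_mem _ _ hmem)
  · rw [h.e_smul_f_smul hq (dot_castSucc_eq_succ (hlam a ha) h1 h2)]
    exact zero_mem _

lemma exists_linearMap_Msigma (hq : (q : ℂ) - (q : ℂ)⁻¹ ≠ 0) (hs : MapsSimpleToSimple c σ)
    (hlam : IsCentral c lam) (lam' : Weight r) :
    ∃ g : Msigma q c σ lam →ₗ[ℂ] Msigma q c σ lam', g (mVec q c σ lam) = mVec q c σ lam' ∧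
      ∀ (a : Fin r) x, g (f q a • x) = f q a • g x := by
  obtain ⟨g, hgv, hgf⟩ := exists_linearMap_verma hq (dot q σ lam) (mVec q c σ lam')
  have hker : ∀ x ∈ singSub q c σ lam, g x = 0 := by
    intro x hx
    refine nSpan_le (P := LinearMap.ker g) ?_ ?_ (singSub_le_nSpan hq hs hlam hx)
    · rintro _ ⟨a, ha, rfl⟩
      have h0 := dynRoot_smul_mVec (q := q) (σ := σ) (lam := lam') ha
      obtain ⟨b, h1, h2⟩ := hs a ha
      rw [h1, h2, dynRoot_castSucc_succ] at h0 ⊢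
      rw [LinearMap.mem_ker, hgf, hgv, h0]
    · intro a x hx
      rw [LinearMap.mem_ker] at hx
      rw [LinearMap.mem_ker, uq_lsmul_apply, hgf, hx, smul_zero]
  refine ⟨liftRestrict _ g hker, ?_, fun a x => ?_⟩
  · rw [mVec, liftRestrict_mkQ, hgv]
  · obtain ⟨u, rfl⟩ := Submodule.mkQ_surjective _ x
    rw [← map_smul, liftRestrict_mkQ, liftRestrict_mkQ, hgf]

lemma exists_linearEquiv_Msigma (hq : (q : ℂ) - (q : ℂ)⁻¹ ≠ 0) (hs : MapsSimpleToSimple c σ)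
    (hlam : IsCentral c lam) (hlam' : IsCentral c lam') :
    ∃ g : Msigma q c σ lam ≃ₗ[ℂ] Msigma q c σ lam', g (mVec q c σ lam) = mVec q c σ lam' ∧
      ∀ (a : Fin r) x, g (f q a • x) = f q a • g x := by
  obtain ⟨g, hgv, hgf⟩ := exists_linearMap_Msigma (q := q) hq hs hlam lam'
  obtain ⟨g', hgv', hgf'⟩ := exists_linearMap_Msigma (q := q) hq hs hlam' lam
  -- Both composites fix the highest weight vector and commute with the `f_α`. That vector generates
  -- over the `f_α` alone, so both are the identity.
  refine ⟨LinearEquiv.ofLinearMap g g' (LinearMap.ext fun x => ?_) (LinearMap.ext fun x => ?_), hgv,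
    hgf⟩
  · refine isHighest_mVec.mem_of_f_smul_mem hq (P := LinearMap.eqLocus (g ∘ₗ g') LinearMap.id)
      ?_ ?_ x
    · simp [LinearMap.mem_eqLocus, hgv, hgv']
    · intro a y hy
      rw [LinearMap.mem_eqLocus, LinearMap.comp_apply] at hy ⊢
      rw [hgf', hgf, hy]
      rfl
  · refine isHighest_mVec.mem_of_f_smul_mem hq (P := LinearMap.eqLocus (g' ∘ₗ g) LinearMap.id)
      ?_ ?_ x
    · simp [LinearMap.mem_eqLocus, hgv, hgv']
    · intro a y hy
      rw [LinearMap.mem_eqLocus, LinearMap.comp_apply] at hy ⊢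
      rw [hgf, hgf', hy]
      rfl

lemma sub_inv_ne_zero_of_pow_ne_one (hq : ∀ d : ℕ, 0 < d → q ^ d ≠ 1) :
    (q : ℂ) - (q : ℂ)⁻¹ ≠ 0 := by
  intro h
  refine hq 2 two_pos (Units.ext ?_)
  have h1 := mul_inv_cancel₀ q.ne_zero
  rw [← sub_eq_zero.1 h] at h1
  simpa [pow_two] using h1

end QuantumGL
end

open QuantumGL in
theorem mainTheorem5 (r : ℕ) (q : ℂˣ) (hq : ∀ d : ℕ, 0 < d → q ^ d ≠ 1)
    (c : Composition (r + 1)) (σ : Equiv.Perm (Fin (r + 1))) (hσ : Admissible c σ) :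
    (∀ lam : Weight r, IsCentral c lam → Regular q c σ lam →
      (∀ m : Fin (r + 1), m ∉ leadSet c σ →
        (Vhat q (dot q σ lam) (m + 1)).map (idProj q c σ lam) =
          (Vhat q (dot q σ lam) m).map (idProj q c σ lam)) ∧
      (∀ (i : Fin c.length) (u : Uq r q), ∀ x ∈ V q c σ lam i,
        tensorRep r q (Msigma q c σ lam) u x ∈ V q c σ lam i) ∧
      (∀ i j : Fin c.length, i ≤ j → V q c σ lam i ≤ V q c σ lam j) ∧
      (∀ i : Fin c.length, (i : ℕ) + 1 = c.length → V q c σ lam i = ⊤)) ∧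
    (MapsSimpleToSimple c σ → ∀ lam lam' : Weight r, IsCentral c lam → IsCentral c lam' →
      ∃ φ : ((Fin (r + 1) → ℂ) ⊗[ℂ] Msigma q c σ lam) ≃ₗ[ℂ]
          ((Fin (r + 1) → ℂ) ⊗[ℂ] Msigma q c σ lam'),
        (∀ y ∈ nMinus r q, ∀ x,
          φ (tensorRep r q (Msigma q c σ lam) y x) =
            tensorRep r q (Msigma q c σ lam') y (φ x)) ∧
        (∀ i : Fin c.length,
          (V q c σ lam i).map (φ : _ →ₗ[ℂ] (Fin (r + 1) → ℂ) ⊗[ℂ] Msigma q c σ lam') =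
            V q c σ lam' i)) := by
  have hq' := sub_inv_ne_zero_of_pow_ne_one hq
  refine ⟨fun lam _ hreg => ⟨fun m hm => ?_, fun i u x hx => ?_, fun i j hij => ?_,
    fun i hi => V_last_eq_top hq' hσ hreg hi⟩, fun hs lam lam' hlam hlam' => ?_⟩
  · rw [Vhat_map_idProj, Vhat_map_idProj]
    exact filt_mVec_succ_eq hq' hσ hreg hm
  · rw [V_eq_filt] at hx ⊢
    exact isHighest_mVec.filt_stable hq' _ u x hx
  · rw [V_eq_filt, V_eq_filt]
    exact filt_mono (Nat.succ_le_succ ((mSigma c σ).monotone hij))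
  · obtain ⟨g, hgv, hgf⟩ := exists_linearEquiv_Msigma (q := q) hq' hs hlam hlam'
    have hf := isHighest_mVec.tensorEquiv_f isHighest_mVec hq' hgv hgf
    refine ⟨tensorEquiv (dot q σ lam) (dot q σ lam') g, fun y hy =>
      map_nMinus (φ := (tensorEquiv (dot q σ lam) (dot q σ lam') g).toLinearMap) hf hy,
      fun i => ?_⟩
    rw [V_eq_filt, V_eq_filt]
    exact tensorEquiv_map_filt hgv hf _
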